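/- Let $\Omega$ be a paracompact locally compact Hausdorff space, and let $\mathcal U=\{\Omega,(A_t)_{t\in\Omega},\Theta\}$ be a continuous field of (complex) $C^*$-algebras in the sense of Dixmier: $\Theta$ is an involutive subalgebra of $\prod_t A_t$ such that $\{x(t):x\in\Theta\}$ is dense in $A_t$ for every $t$, the function $t\mapsto\|x(t)\|$ is continuous for every $x\in\Theta$, and every vector field that can be approximated near each point, uniformly within every $\varepsilon>0$ on a neighbourhood, by elements of $\Theta$ belongs to $\Theta$. For $Y\subseteq\Omega$, $\mathcal U|_Y$ is the field over $Y$ whose continuous vector fields are those $x\in\prod_{t\in Y}A_t$ that can be so approximated near each point of $Y$ by elements of $\Theta$. A field is *trivial* if it is isomorphic, through $*$-isomorphisms of the fibres carrying one set of continuous vector fields onto the other, to a constant field (whose continuous vector fields are the continuous maps into a fixed $C^*$-algebra). Suppose that $\mathcal U$ is locally trivial (every point has an open neighbourhood $V$ such that $\mathcal U|_V$ is trivial), and that each $A_t$ contains a strictly positive element, that is, some $h\ge 0$ with $f(h)>0$ for every non-zero positive linear functional $f$ on $A_t$. Let $\ell\ge 1$ be an integer, and suppose that one of the following conditions holds: (i)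 $\dim\Omega\le\ell$, that is, every locally finite open cover of $\Omega$ has a locally finite open refinement that covers $\Omega$ and in which each point lies in at most $\ell+1$ members; (ii) $\mathcal U$ is $\ell$-locally trivial, that is, there are an open cover $\{U_\mu\}$ of $\Omega$ such that each $\mathcal U|_{U_\mu}$ is trivial, and an open cover $V_1,\dots,V_\ell$ of $\Omega$ such that each closure $\overline{V_j}$ is contained in some $U_\mu$. Let $\mathfrak A$ be the $C^*$-algebra of those $x\in\Theta$ for which $\|x(t)\|$ vanishes at infinity, with the supremum norm. Then $\mathfrak A$ is left projective: for every left Banach $\mathfrak A$-module $Y$, every morphism of left Banach $\mathfrak A$-modules $\varphi:Y\to\mathfrak A$ that has a bounded linear right inverse has a right inverse that is a morphism of left Banach $\mathfrak A$-modules. Moreover, there is a morphism of left Banach $\mathfrak A$-modules $\rho:\mathfrak A\to\mathfrak A\,\widehat\otimes\,\mathfrak A$ into the projective tensor product such that $\pi\circ\rho=\mathrm{id}_{\mathfrak A}$, where $\pi(a\otimes b)=ab$, and $\|\rho\|\le(4\ell)^2$. -/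

import Mathlib

open Filter Topology Set
open scoped ENNReal TensorProduct

universe u v w

noncomputable section

/-! ### Banach modules, projectivity, and the projective tensor square -/

section BanachModules

variable (A : Type v) [NonUnitalNormedRing A] [NormedSpace ℂ A] [IsScalarTower ℂ A A]
  [SMulCommClass ℂ A A]

/-- The structure of a left Banach `A`-module on a Banach space `Y`: a bounded bilinear map
`A × Y → Y`, `(a, y) ↦ a · y`, such that `(a b) · y = a · (b · y)`.  The algebra `A` need not have
an identity. -/
structure LeftBanachModule (Y : Type w) [NormedAddCommGroup Y] [NormedSpace ℂ Y] where
  /-- The action, as a bounded bilinear map. -/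
  act : A →L[ℂ] Y →L[ℂ] Y
  mul_act : ∀ (a b : A) (y : Y), act (a * b) y = act a (act b y)

/-- A Banach algebra `A` as a left Banach module over itself. -/
def LeftBanachModule.regular : LeftBanachModule A A where
  act := ContinuousLinearMap.mul ℂ A
  mul_act a b y := by simp [mul_assoc]

variable {A}

/-- A bounded linear map is a morphism of left Banach `A`-modules. -/
def IsModuleMorphism {X Y : Type*} [NormedAddCommGroup X] [NormedSpace ℂ X]
    [NormedAddCommGroup Y] [NormedSpace ℂ Y] (mX : LeftBanachModule A X)
    (mY : LeftBanachModule A Y) (f : X →L[ℂ] Y) : Prop :=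
  ∀ (a : A) (x : X), f (mX.act a x) = mY.act a (f x)

/-- A left Banach `A`-module `P` is projective: for every left Banach `A`-module `Y`, every morphism
`φ : Y → P` that has a right inverse as a morphism of Banach spaces (so that `φ` is onto) has a
right inverse which is a morphism of left Banach `A`-modules. -/
def LeftBanachModule.IsProjective {P : Type*} [NormedAddCommGroup P] [NormedSpace ℂ P]
    (mP : LeftBanachModule A P) : Prop :=
  ∀ (Y : Type w) [NormedAddCommGroup Y] [NormedSpace ℂ Y] [CompleteSpace Y]
    (mY : LeftBanachModule A Y) (φ : Y →L[ℂ] P), IsModuleMorphism mY mP φ →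
    (∃ σ : P →L[ℂ] Y, ∀ x, φ (σ x) = x) →
    ∃ ψ : P →L[ℂ] Y, IsModuleMorphism mP mY ψ ∧ ∀ x, φ (ψ x) = x

variable (A)

/-- The Banach algebra `A` is left projective: it is projective as a left Banach module over itself
(tested on Banach modules in the universe `w`, which is arbitrary). -/
def IsLeftProjective : Prop :=
  LeftBanachModule.IsProjective.{v, w} (LeftBanachModule.regular A)

/-- The completed projective tensor product `A ⊗̂ A`: the completion of the algebraic tensor product
`A ⊗ A` in the projective norm `‖u‖ = inf {∑ ‖xₖ‖ ‖yₖ‖ : u = ∑ xₖ ⊗ yₖ}`, which is the norm that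
Mathlib puts on `⨂[ℂ] i, Eᵢ`. -/
abbrev ProjTensorSquare : Type v :=
  UniformSpace.Completion (⨂[ℂ] _ : Fin 2, A)

namespace ProjTensorSquare

variable {A}

/-- The elementary tensor `b ⊗ c` in `A ⊗̂ A`. -/
def tmul (b c : A) : ProjTensorSquare A :=
  ((PiTensorProduct.tprod ℂ (fun i : Fin 2 => ![b, c] i) : ⨂[ℂ] _ : Fin 2, A) :
    UniformSpace.Completion (⨂[ℂ] _ : Fin 2, A))

/-- The bounded operator `b ⊗ c ↦ (a b) ⊗ c` on `A ⊗̂ A`. -/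
def leftMul (a : A) : ProjTensorSquare A →L[ℂ] ProjTensorSquare A :=
  (PiTensorProduct.mapL (fun i : Fin 2 =>
    (![ContinuousLinearMap.mul ℂ A a, ContinuousLinearMap.id ℂ A] i : A →L[ℂ] A))).completion

theorem leftMul_tmul (a b c : A) : leftMul a (tmul b c) = tmul (a * b) c := by
  unfold leftMul tmul
  rw [ContinuousLinearMap.completion_apply_coe, PiTensorProduct.mapL_apply,
    PiTensorProduct.map_tprod]
  congr 2
  funext i
  fin_cases i <;> simp

/-- The multiplication of `A` as a bounded `2`-linear map. -/
def mulMultilinear : ContinuousMultilinearMap ℂ (fun _ : Fin 2 => A) A :=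
  MultilinearMap.mkContinuous
    (MultilinearMap.mk' (fun m : Fin 2 → A => m 0 * m 1)
      (by intro m i x y; fin_cases i <;> simp [add_mul, mul_add])
      (by intro m i c x; fin_cases i <;> simp [smul_mul_assoc, mul_smul_comm]))
    1 (fun m => by simpa using norm_mul_le (m 0) (m 1))

variable [CompleteSpace A]

/-- The canonical morphism `π : A ⊗̂ A → A`, `b ⊗ c ↦ b c`. -/
def mulMap : ProjTensorSquare A →L[ℂ] A :=
  (PiTensorProduct.liftIsometry ℂ (fun _ : Fin 2 => A) A mulMultilinear).fromCompletion

theorem mulMap_tmul (b c : A) : mulMap (tmul b c) = b * c := by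
  unfold mulMap tmul
  rw [ContinuousLinearMap.fromCompletion_apply_coe, PiTensorProduct.liftIsometry_apply_apply,
    PiTensorProduct.lift.tprod]
  simp [mulMultilinear]

end ProjTensorSquare

end BanachModules

/-! ### Strictly positive elements -/

/-- An element `h` of a C⋆-algebra is strictly positive: it is positive, and `f h > 0` for every
non-zero positive linear functional `f`. -/
def IsStrictlyPositiveElement {A : Type*} [NonUnitalCStarAlgebra A] (h : A) : Prop :=
  (∃ b : A, h = star b * b) ∧
    ∀ f : A →ₗ[ℂ] ℂ, (∀ b : A, 0 ≤ (f (star b * b)).re ∧ (f (star b * b)).im = 0) → f ≠ 0 →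
      0 < (f h).re

/-! ### Topological dimension -/

/-- `dim Ω ≤ n`: every locally finite open cover of `Ω` has a locally finite open refinement that
covers `Ω` and in which every point lies in at most `n + 1` members. -/
def CoveringDimLE (Ω : Type u) [TopologicalSpace Ω] (n : ℕ) : Prop :=
  ∀ 𝒱 : Set (Set Ω), (∀ V ∈ 𝒱, IsOpen V) → ⋃₀ 𝒱 = univ →
    LocallyFinite (fun V : 𝒱 => (V : Set Ω)) →
    ∃ 𝒲 : Set (Set Ω), (∀ W ∈ 𝒲, IsOpen W) ∧ ⋃₀ 𝒲 = univ ∧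
      LocallyFinite (fun W : 𝒲 => (W : Set Ω)) ∧ (∀ W ∈ 𝒲, ∃ V ∈ 𝒱, W ⊆ V) ∧
      ∀ x : Ω, {W ∈ 𝒲 | x ∈ W}.encard ≤ (n : ℕ∞) + 1

/-! ### Continuous fields of C⋆-algebras -/

/-- A continuous field of C⋆-algebras over `Ω` with fibres `A t`. -/
structure ContinuousField {Ω : Type u} [TopologicalSpace Ω] (A : Ω → Type v)
    [∀ t, NonUnitalCStarAlgebra (A t)] where
  /-- The continuous vector fields: an involutive subalgebra of the product of the fibres. -/
  Θ : NonUnitalStarSubalgebra ℂ (∀ t, A t)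
  dense_eval : ∀ t, Dense {a : A t | ∃ x ∈ Θ, x t = a}
  continuous_norm : ∀ x ∈ Θ, Continuous fun t => ‖x t‖
  mem_of_locally_approx : ∀ x : ∀ t, A t,
    (∀ t, ∀ ε > (0 : ℝ), ∃ x' ∈ Θ, ∀ᶠ s in 𝓝 t, ‖x s - x' s‖ ≤ ε) → x ∈ Θ

namespace ContinuousField

variable {Ω : Type u} [TopologicalSpace Ω] {A : Ω → Type v} [∀ t, NonUnitalCStarAlgebra (A t)]

/-- A vector field `x` over `Y ⊆ Ω` is continuous at `t ∈ Y`. -/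
def ContAt (U : ContinuousField A) (Y : Set Ω) (x : ∀ t : Y, A t) (t : Y) : Prop :=
  ∀ ε > (0 : ℝ), ∃ x' ∈ U.Θ, ∀ᶠ s in 𝓝 t, ‖x s - x' s‖ ≤ ε

theorem ContAt.of_mem (U : ContinuousField A) (Y : Set Ω) {x : ∀ t, A t} (hx : x ∈ U.Θ) (t : Y) :
    U.ContAt Y (fun s => x s) t :=
  fun ε hε => ⟨x, hx, Eventually.of_forall fun s => by simpa using hε.le⟩

theorem eventually_norm_le (U : ContinuousField A) (Y : Set Ω) {x : ∀ t, A t} (hx : x ∈ U.Θ)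
    (t : Y) : ∀ᶠ s : Y in 𝓝 t, ‖x s‖ ≤ ‖x t‖ + 1 := by
  have h : Continuous fun s : Y => ‖x s‖ := (U.continuous_norm x hx).comp continuous_subtype_val
  filter_upwards [h.continuousAt.eventually_lt_const (lt_add_one ‖x t‖)] with s hs using hs.le

theorem ContAt.mul (U : ContinuousField A) (Y : Set Ω) {x y : ∀ t : Y, A t} {t : Y}
    (hx : U.ContAt Y x t) (hy : U.ContAt Y y t) : U.ContAt Y (x * y) t := by
  intro ε hε
  obtain ⟨y₁, hy₁, hyy₁⟩ := hy 1 one_pos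
  have hM : (0 : ℝ) < ‖y₁ t‖ + 2 := by positivity
  obtain ⟨x', hx', hxx'⟩ := hx (ε / 2 / (‖y₁ t‖ + 2)) (by positivity)
  have hN : (0 : ℝ) < ‖x' t‖ + 1 := by positivity
  obtain ⟨y', hy', hyy'⟩ := hy (ε / 2 / (‖x' t‖ + 1)) (by positivity)
  refine ⟨x' * y', mul_mem hx' hy', ?_⟩
  filter_upwards [hyy₁, hxx', hyy', U.eventually_norm_le Y hy₁ t, U.eventually_norm_le Y hx' t]
    with s h1 h2 h3 h4 h5
  have hys : ‖y s‖ ≤ ‖y₁ t‖ + 2 := by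
    have := norm_add_le (y s - y₁ s) (y₁ s)
    rw [sub_add_cancel] at this
    linarith
  have e : (x * y) s - (x' * y') s = (x s - x' s) * y s + x' s * (y s - y' s) := by
    simp only [Pi.mul_apply]
    noncomm_ring
  rw [e]
  calc _ ≤ ‖x s - x' s‖ * ‖y s‖ + ‖x' s‖ * ‖y s - y' s‖ :=
        (norm_add_le _ _).trans (add_le_add (norm_mul_le _ _) (norm_mul_le _ _))
    _ ≤ ε / 2 / (‖y₁ t‖ + 2) * (‖y₁ t‖ + 2) + (‖x' t‖ + 1) * (ε / 2 / (‖x' t‖ + 1)) := by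
        gcongr
    _ = ε := by field_simp; ring

theorem ContAt.add (U : ContinuousField A) (Y : Set Ω) {x y : ∀ t : Y, A t} {t : Y}
    (hx : U.ContAt Y x t) (hy : U.ContAt Y y t) : U.ContAt Y (x + y) t := by
  intro ε hε
  obtain ⟨x', hx', hxx'⟩ := hx (ε / 2) (by positivity)
  obtain ⟨y', hy', hyy'⟩ := hy (ε / 2) (by positivity)
  refine ⟨x' + y', add_mem hx' hy', ?_⟩
  filter_upwards [hxx', hyy'] with s h1 h2
  have e : (x + y) s - (x' + y') s = (x s - x' s) + (y s - y' s) := by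
    simp only [Pi.add_apply]
    abel
  rw [e]
  linarith [norm_add_le (x s - x' s) (y s - y' s)]

theorem ContAt.smul (U : ContinuousField A) (Y : Set Ω) (c : ℂ) {x : ∀ t : Y, A t} {t : Y}
    (hx : U.ContAt Y x t) : U.ContAt Y (c • x) t := by
  intro ε hε
  have hc : (0 : ℝ) < ‖c‖ + 1 := by positivity
  obtain ⟨x', hx', hxx'⟩ := hx (ε / (‖c‖ + 1)) (by positivity)
  refine ⟨c • x', SMulMemClass.smul_mem c hx', ?_⟩
  filter_upwards [hxx'] with s h1
  simp only [Pi.smul_apply]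
  rw [← smul_sub, norm_smul]
  calc ‖c‖ * ‖x s - x' s‖ ≤ (‖c‖ + 1) * (ε / (‖c‖ + 1)) := by gcongr; linarith
    _ = ε := by field_simp

theorem ContAt.star (U : ContinuousField A) (Y : Set Ω) {x : ∀ t : Y, A t} {t : Y}
    (hx : U.ContAt Y x t) : U.ContAt Y (star x) t := by
  intro ε hε
  obtain ⟨x', hx', hxx'⟩ := hx ε hε
  refine ⟨Star.star x', star_mem hx', ?_⟩
  filter_upwards [hxx'] with s h1
  simp only [Pi.star_apply]
  rwa [← star_sub, norm_star]

/-- The field induced by `U` on `Y ⊆ Ω`; its continuous vector fields are the vector fields over `Y`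
that are continuous at every point of `Y`. -/
def restrict (U : ContinuousField A) (Y : Set Ω) : ContinuousField (fun t : Y => A t) where
  Θ :=
    { carrier := {x | ∀ t : Y, U.ContAt Y x t}
      add_mem' := fun hx hy t => (hx t).add U Y (hy t)
      zero_mem' := fun t => ContAt.of_mem U Y (zero_mem U.Θ) t
      mul_mem' := fun hx hy t => (hx t).mul U Y (hy t)
      smul_mem' := fun c _ hx t => (hx t).smul U Y c
      star_mem' := fun hx t => (hx t).star U Y }
  dense_eval t := by
    refine (U.dense_eval t).mono ?_
    rintro _ ⟨x, hx, rfl⟩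
    exact ⟨fun s => x s, fun s => ContAt.of_mem U Y hx s, rfl⟩
  continuous_norm x hx := by
    rw [continuous_iff_continuousAt]
    intro t
    rw [ContinuousAt, Metric.tendsto_nhds]
    intro ε hε
    obtain ⟨x', hx', h⟩ := hx t (ε / 4) (by positivity)
    have hc : Continuous fun s : Y => ‖x' s‖ :=
      (U.continuous_norm x' hx').comp continuous_subtype_val
    have ht := h.self_of_nhds
    filter_upwards [h, (Metric.tendsto_nhds.1 hc.continuousAt) (ε / 4) (by positivity)]
      with s h1 h2
    rw [Real.dist_eq] at h2 ⊢
    have a1 := abs_norm_sub_norm_le (x s) (x' s)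
    have a2 := abs_norm_sub_norm_le (x t) (x' t)
    rw [abs_lt] at h2 ⊢
    rw [abs_le] at a1 a2
    constructor <;> linarith [a1.1, a1.2, a2.1, a2.2, h2.1, h2.2]
  mem_of_locally_approx x hx t ε hε := by
    obtain ⟨y, hy, h⟩ := hx t (ε / 2) (by positivity)
    obtain ⟨x', hx', h'⟩ := hy t (ε / 2) (by positivity)
    refine ⟨x', hx', ?_⟩
    filter_upwards [h, h'] with s h1 h2
    have := norm_add_le (x s - y s) (y s - x' s)
    rw [sub_add_sub_cancel] at this
    linarith

/-- The constant field over `Ω` defined by a C⋆-algebra `B`: its continuous vector fields are the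
continuous maps `Ω → B`. -/
def const (Ω : Type u) [TopologicalSpace Ω] (B : Type v) [NonUnitalCStarAlgebra B] :
    ContinuousField (fun _ : Ω => B) where
  Θ :=
    { carrier := {x | Continuous x}
      add_mem' := fun hx hy => Continuous.add hx hy
      zero_mem' := continuous_const
      mul_mem' := fun hx hy => Continuous.mul hx hy
      smul_mem' := fun c _ hx => Continuous.const_smul hx c
      star_mem' := fun hx => Continuous.star hx }
  dense_eval t := by
    refine dense_univ.mono ?_
    intro b _
    exact ⟨fun _ => b, continuous_const, rfl⟩
  continuous_norm x hx := Continuous.norm hx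
  mem_of_locally_approx x hx := by
    refine continuous_iff_continuousAt.2 fun t => ?_
    rw [ContinuousAt, Metric.tendsto_nhds]
    intro ε hε
    obtain ⟨x', hx', h⟩ := hx t (ε / 4) (by positivity)
    have hc : Continuous x' := hx'
    have ht := h.self_of_nhds
    filter_upwards [h, (Metric.tendsto_nhds.1 hc.continuousAt) (ε / 4) (by positivity)]
      with s h1 h2
    rw [← dist_eq_norm] at h1 ht
    have := dist_triangle4 (x s) (x' s) (x' t) (x t)
    rw [dist_comm (x' t)] at this
    linarith

/-- An isomorphism of two continuous fields over `Ω`: a family of `*`-isomorphisms of the fibres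
(which are automatically isometric) that carries the continuous vector fields of the first onto
those of the second. -/
structure Iso {A' : Ω → Type w} [∀ t, NonUnitalCStarAlgebra (A' t)] (U : ContinuousField A)
    (U' : ContinuousField A') where
  φ : ∀ t, A t ≃⋆ₐ[ℂ] A' t
  mem_iff : ∀ x : ∀ t, A t, x ∈ U.Θ ↔ (fun t => φ t (x t)) ∈ U'.Θ

/-- A field is trivial if it is isomorphic to a constant field. -/
def IsTrivial (U : ContinuousField A) : Prop :=
  ∃ (B : Type v) (_ : NonUnitalCStarAlgebra B), Nonempty (U.Iso (const Ω B))

/-- Every point has an open neighbourhood on which the field is trivial. -/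
def IsLocallyTrivial (U : ContinuousField A) : Prop :=
  ∀ t, ∃ V : Set Ω, IsOpen V ∧ t ∈ V ∧ (U.restrict V).IsTrivial

/-- `n`-local triviality: there are an open cover `𝒰` of `Ω` with `U` trivial on each member of
`𝒰`, and an open cover `V₁, …, Vₙ` of `Ω` such that each closure of `Vⱼ` is contained in some member
of `𝒰`. -/
def IsNLocallyTrivial (U : ContinuousField A) (n : ℕ) : Prop :=
  ∃ 𝒰 : Set (Set Ω), (∀ W ∈ 𝒰, IsOpen W) ∧ ⋃₀ 𝒰 = univ ∧ (∀ W ∈ 𝒰, (U.restrict W).IsTrivial) ∧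
    ∃ V : Fin n → Set Ω, (∀ j, IsOpen (V j)) ∧ ⋃ j, V j = univ ∧
      ∀ j, ∃ W ∈ 𝒰, closure (V j) ⊆ W

/-- The C⋆-algebra defined by the field `U`: the continuous vector fields `x` for which `‖x t‖`
vanishes at infinity on `Ω`, with the supremum norm and the pointwise operations.  Such `x` are
bounded (see `exists_mem_sectionAlgebra`), and so the algebra is a subalgebra of the C⋆-algebra
`lp A ∞` of all bounded vector fields. -/
def sectionAlgebra (U : ContinuousField A) : NonUnitalStarSubalgebra ℂ (lp A ∞) where
  carrier := {x | (fun t => x t) ∈ U.Θ ∧ Tendsto (fun t => ‖x t‖) (cocompact Ω) (𝓝 0)}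
  add_mem' := by
    rintro x y ⟨hx, hx0⟩ ⟨hy, hy0⟩
    refine ⟨add_mem hx hy, ?_⟩
    refine squeeze_zero (fun t => norm_nonneg _) (fun t => norm_add_le (x t) (y t)) ?_
    simpa using hx0.add hy0
  zero_mem' := ⟨zero_mem U.Θ, by simpa using tendsto_const_nhds⟩
  mul_mem' := by
    rintro x y ⟨hx, hx0⟩ ⟨hy, hy0⟩
    refine ⟨mul_mem hx hy, ?_⟩
    refine squeeze_zero (fun t => norm_nonneg _) (fun t => norm_mul_le (x t) (y t)) ?_
    simpa using hx0.mul hy0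
  smul_mem' := by
    rintro c x ⟨hx, hx0⟩
    refine ⟨SMulMemClass.smul_mem c hx, ?_⟩
    simp only [lp.coeFn_smul, Pi.smul_apply, norm_smul]
    simpa using hx0.const_mul ‖c‖
  star_mem' := by
    rintro x ⟨hx, hx0⟩
    refine ⟨star_mem (s := U.Θ) hx, ?_⟩
    simpa using hx0

theorem mem_sectionAlgebra (U : ContinuousField A) (x : lp A ∞) : x ∈ U.sectionAlgebra ↔
    (fun t => x t) ∈ U.Θ ∧ Tendsto (fun t => ‖x t‖) (cocompact Ω) (𝓝 0) :=
  Iff.rfl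

/-- The supremum norm of the algebra of sections. -/
theorem norm_sectionAlgebra (U : ContinuousField A) (x : U.sectionAlgebra) :
    ‖x‖ = ⨆ t, ‖(x : lp A ∞) t‖ :=
  lp.norm_eq_ciSup (x : lp A ∞)

/-- Every continuous vector field that vanishes at infinity is an element of the algebra. -/
theorem exists_mem_sectionAlgebra (U : ContinuousField A) (x : ∀ t, A t) (hx : x ∈ U.Θ)
    (hx0 : Tendsto (fun t => ‖x t‖) (cocompact Ω) (𝓝 0)) :
    ∃ y : U.sectionAlgebra, ∀ t, (y : lp A ∞) t = x t := by
  have hb : Memℓp x ∞ := by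
    refine memℓp_infty ?_
    obtain ⟨K, hK, h⟩ := mem_cocompact.1 (hx0.eventually_lt_const one_pos)
    obtain ⟨M, hM⟩ := (hK.image (U.continuous_norm x hx)).bddAbove
    refine ⟨max M 1, ?_⟩
    rintro _ ⟨t, rfl⟩
    by_cases ht : t ∈ K
    · exact le_max_of_le_left (hM ⟨t, ht, rfl⟩)
    · exact le_max_of_le_right (le_of_lt (h ht))
  exact ⟨⟨⟨x, hb⟩, hx, hx0⟩, fun t => rfl⟩

/-- The algebra of sections is closed in the algebra of all bounded vector fields, so that it is a
C⋆-algebra. -/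
instance isClosed_sectionAlgebra (U : ContinuousField A) :
    IsClosed (U.sectionAlgebra : Set (lp A ∞)) := by
  refine isClosed_of_closure_subset fun x hx => ?_
  have key : ∀ ε > (0 : ℝ), ∃ y ∈ U.sectionAlgebra, ∀ t, ‖x t - y t‖ ≤ ε := by
    intro ε hε
    obtain ⟨y, hy, h⟩ := Metric.mem_closure_iff.1 hx ε hε
    refine ⟨y, hy, fun t => ?_⟩
    rw [dist_eq_norm] at h
    exact (lp.norm_apply_le_norm ENNReal.top_ne_zero (x - y) t).trans h.le
  refine ⟨U.mem_of_locally_approx _ fun t ε hε => ?_, ?_⟩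
  · obtain ⟨y, hy, h⟩ := key ε hε
    exact ⟨fun s => y s, hy.1, Eventually.of_forall h⟩
  · rw [Metric.tendsto_nhds]
    intro ε hε
    obtain ⟨y, hy, h⟩ := key (ε / 2) (by positivity)
    filter_upwards [hy.2.eventually_lt_const (show (0 : ℝ) < ε / 2 by positivity)] with t ht
    have := norm_add_le (x t - y t) (y t)
    rw [sub_add_cancel] at this
    simp only [dist_zero_right, norm_norm]
    linarith [h t]

end ContinuousField

end

open Filter Topology Set
open scoped ENNReal TensorProduct

noncomputable section

/-! ### Averaging over signs -/

section Averaging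

/-! The splitting is explicit: `ρ a = ∑ (a f_k) ⊗ f_k`, for a family `f_k` in the algebra such that
`∑ a f_k f_k = a` and every finite sum `∑ ε_k f_k` with `|ε_k| ≤ 1` has norm at most `C`
(`IsDiagonalFamily`). The series need not converge absolutely. However, `∑ x_k ⊗ y_k` is the average
over signs of `(∑ ε_k x_k) ⊗ (∑ ε_k y_k)`, so all partial sums have norm at most `C² ‖a‖`
(`norm_bilinear_add_sum_le`). Since they are eventually constant for `a` in a dense set, they
converge. Replacing `⊗` by `(x, y) ↦ x · σ y` turns a bounded linear section `σ` into a module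
section, which is projectivity.

It remains to find such a family with `C = 4`. Local strictly positive sections are glued to a
section `x` that is strictly positive in every fibre (`exists_strictlyPositive`). A partition of
unity `θ_i` with compact supports is regrouped so that at most two members are non-zero at any point
(`exists_partitionOfUnity_multiplicity_two`). With cut-offs `u_k` increasing to `1` away from `0`,
put `f_(i,k) = √θ_i · √(u_(k+1) - u_k)(x)`. The squares telescope to an approximate identity, by
strict positivity. At each point of the base and of the spectrum at most two indices `i` and two
indices `k` contribute, which gives `C = 2 · 2`. -/

theorem norm_add_smul_add_sum_le {V κ : Type*} [NormedAddCommGroup V] [NormedSpace ℂ V]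
    [DecidableEq κ] {F : Finset κ} {k₀ : κ} (hk : k₀ ∉ F) {z : κ → V} {z₀ : V} {E : ℝ}
    (hz : ∀ ε : κ → ℂ, (∀ k, ‖ε k‖ ≤ 1) → ‖z₀ + ∑ k ∈ insert k₀ F, ε k • z k‖ ≤ E)
    {s : ℂ} (hs : ‖s‖ ≤ 1) (ε : κ → ℂ) (hε : ∀ k, ‖ε k‖ ≤ 1) :
    ‖(z₀ + s • z k₀) + ∑ k ∈ F, ε k • z k‖ ≤ E := by
  have := hz (Function.update ε k₀ s) (fun k => by
    by_cases h : k = k₀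
    · subst h; simpa using hs
    · simpa [Function.update_of_ne h] using hε k)
  rw [Finset.sum_insert hk, Function.update_self] at this
  rw [add_assoc]
  convert this using 4
  refine Finset.sum_congr rfl fun k hkF => ?_
  rw [Function.update_of_ne (ne_of_mem_of_not_mem hkF hk)]

/-- The norm of a diagonal sum `∑ B (x k) (y k)` is controlled by the norms of the signed sums of the
`x k` and of the `y k`, since it is an average of the values of `B` at such sums. -/
theorem norm_bilinear_add_sum_le {X Y Z κ : Type*} [NormedAddCommGroup X] [NormedSpace ℂ X]
    [NormedAddCommGroup Y] [NormedSpace ℂ Y] [NormedAddCommGroup Z] [NormedSpace ℂ Z]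
    (B : X →L[ℂ] Y →L[ℂ] Z) {K : ℝ} (hK : 0 ≤ K) (hB : ∀ x y, ‖B x y‖ ≤ K * ‖x‖ * ‖y‖)
    (x : κ → X) (y : κ → Y) {C D : ℝ} (F : Finset κ) :
    ∀ (x₀ : X) (y₀ : Y),
      (∀ ε : κ → ℂ, (∀ k, ‖ε k‖ ≤ 1) → ‖x₀ + ∑ k ∈ F, ε k • x k‖ ≤ C) →
      (∀ ε : κ → ℂ, (∀ k, ‖ε k‖ ≤ 1) → ‖y₀ + ∑ k ∈ F, ε k • y k‖ ≤ D) →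
      ‖B x₀ y₀ + ∑ k ∈ F, B (x k) (y k)‖ ≤ K * C * D := by
  classical
  induction F using Finset.induction_on with
  | empty =>
    intro x₀ y₀ hx hy
    have h1 := hx 0 (by simp)
    have h2 := hy 0 (by simp)
    simp only [Finset.sum_empty, add_zero] at h1 h2 ⊢
    calc ‖B x₀ y₀‖ ≤ K * ‖x₀‖ * ‖y₀‖ := hB x₀ y₀
      _ ≤ K * C * D := by
        have : 0 ≤ C := (norm_nonneg _).trans h1
        gcongr
  | insert k₀ F hk ih =>
    intro x₀ y₀ hx hy
    -- The signs `±1` of `k₀` are absorbed into the fixed parts. In the mean of the two values of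
    -- `B` the cross terms cancel and `B (x k₀) (y k₀)` survives.
    have hp := ih (x₀ + (1 : ℂ) • x k₀) (y₀ + (1 : ℂ) • y k₀) (norm_add_smul_add_sum_le hk hx (by simp))
      (norm_add_smul_add_sum_le hk hy (by simp))
    have hm := ih (x₀ + (-1 : ℂ) • x k₀) (y₀ + (-1 : ℂ) • y k₀) (norm_add_smul_add_sum_le hk hx (by simp))
      (norm_add_smul_add_sum_le hk hy (by simp))
    rw [Finset.sum_insert hk]
    set S := ∑ k ∈ F, B (x k) (y k)
    have e : (B x₀ y₀ + (B (x k₀) (y k₀) + S)) = (2⁻¹ : ℂ) •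
        ((B (x₀ + (1 : ℂ) • x k₀) (y₀ + (1 : ℂ) • y k₀) + S) +
          (B (x₀ + (-1 : ℂ) • x k₀) (y₀ + (-1 : ℂ) • y k₀) + S)) := by
      simp only [map_add, map_smul, add_apply, smul_apply]
      module
    rw [e, norm_smul]
    have := norm_add_le (B (x₀ + (1 : ℂ) • x k₀) (y₀ + (1 : ℂ) • y k₀) + S)
          (B (x₀ + (-1 : ℂ) • x k₀) (y₀ + (-1 : ℂ) • y k₀) + S)
    rw [norm_inv, Complex.norm_ofNat]
    linarith

variable {A : Type*} [NonUnitalNormedRing A] [NormedSpace ℂ A] [IsScalarTower ℂ A A]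
  [SMulCommClass ℂ A A] {κ : Type*}

/-- A family in a Banach algebra whose signed finite sums are bounded by `C` and whose squares sum to
a right approximate identity, exactly so on a dense set of elements annihilating all but finitely
many members of the family. -/
structure IsDiagonalFamily (f : κ → A) (C : ℝ) : Prop where
  norm_sum_le : ∀ (F : Finset κ) (ε : κ → ℂ), (∀ k, ‖ε k‖ ≤ 1) → ‖∑ k ∈ F, ε k • f k‖ ≤ C
  dense : Dense {a : A | ∃ F : Finset κ, (∀ k ∉ F, a * f k = 0) ∧ ∑ k ∈ F, a * f k * f k = a}

namespace IsDiagonalFamily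

variable {f : κ → A} {C : ℝ} {Z : Type*} [NormedAddCommGroup Z] [NormedSpace ℂ Z]

omit [IsScalarTower ℂ A A] in
-- A signed sum of the `a * f k` is `a` times a signed sum of the `f k`. The bound is uniform in
-- `F`, which replaces absolute convergence.
theorem norm_sum_bilinear_le (hf : IsDiagonalFamily f C) (B : A →L[ℂ] A →L[ℂ] Z)
    {K : ℝ} (hK : 0 ≤ K) (hB : ∀ x y, ‖B x y‖ ≤ K * ‖x‖ * ‖y‖) (F : Finset κ)
    (a : A) : ‖∑ k ∈ F, B (a * f k) (f k)‖ ≤ K * C ^ 2 * ‖a‖ := by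
  have := norm_bilinear_add_sum_le B hK hB (fun k => a * f k) f (C := ‖a‖ * C) (D := C) F 0 0
    (fun ε hε => by
      simp_rw [zero_add, ← mul_smul_comm, ← Finset.mul_sum]
      exact (norm_mul_le _ _).trans (by gcongr; exact hf.norm_sum_le F ε hε))
    (fun ε hε => by simpa using hf.norm_sum_le F ε hε)
  simp only [map_zero, zero_add] at this
  exact this.trans_eq (by ring)

omit [IsScalarTower ℂ A A] in
-- Uniformly bounded operators that are eventually constant at each point of a dense set form a
-- pointwise Cauchy net.
theorem cauchySeq_sum_bilinear (hf : IsDiagonalFamily f C) (B : A →L[ℂ] A →L[ℂ] Z)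
    {K : ℝ} (hK : 0 ≤ K) (hB : ∀ x y, ‖B x y‖ ≤ K * ‖x‖ * ‖y‖) (a : A) :
    CauchySeq fun F : Finset κ => ∑ k ∈ F, B (a * f k) (f k) := by
  classical
  rw [Metric.cauchySeq_iff']
  intro ε hε
  have hM : 0 ≤ K * C ^ 2 := by positivity
  -- The `+ 1` keeps the radius meaningful when `K * C ^ 2 = 0`.
  obtain ⟨d, hd, F₀, hF₀, -⟩ := Metric.dense_iff.1 hf.dense a (ε / (2 * (K * C ^ 2 + 1)))
    (by positivity)
  refine ⟨F₀, fun F hF => ?_⟩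
  have e : ∑ k ∈ F, B (d * f k) (f k) = ∑ k ∈ F₀, B (d * f k) (f k) :=
    (Finset.sum_subset hF fun k _ hk => by simp [hF₀ k hk]).symm
  have sub : ∀ G : Finset κ, ∑ k ∈ G, B (a * f k) (f k) - ∑ k ∈ G, B (d * f k) (f k) =
      ∑ k ∈ G, B ((a - d) * f k) (f k) := fun G => by
    simp [← Finset.sum_sub_distrib, sub_mul]
  have hG : ∀ G : Finset κ, ‖∑ k ∈ G, B (a * f k) (f k) - ∑ k ∈ G, B (d * f k) (f k)‖ < ε / 2 := by
    intro G
    rw [sub]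
    rw [Metric.mem_ball, dist_comm, dist_eq_norm] at hd
    calc _ ≤ K * C ^ 2 * ‖a - d‖ := hf.norm_sum_bilinear_le B hK hB G (a - d)
      _ ≤ (K * C ^ 2) * (ε / (2 * (K * C ^ 2 + 1))) := by gcongr
      _ < (K * C ^ 2 + 1) * (ε / (2 * (K * C ^ 2 + 1))) := by gcongr; linarith
      _ = ε / 2 := by field_simp
  rw [dist_eq_norm]
  have h1 := hG F
  have h2 := hG F₀
  rw [e] at h1
  rw [norm_sub_rev] at h2
  have := norm_add_le (∑ k ∈ F, B (a * f k) (f k) - ∑ k ∈ F₀, B (d * f k) (f k))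
    (∑ k ∈ F₀, B (d * f k) (f k) - ∑ k ∈ F₀, B (a * f k) (f k))
  rw [sub_add_sub_cancel] at this
  linarith

/-- Used for three choices of `B`: the product, the elementary tensor, and `(x, y) ↦ x · σ y`. -/
theorem exists_limit (hf : IsDiagonalFamily f C) [CompleteSpace Z] (B : A →L[ℂ] A →L[ℂ] Z)
    {K : ℝ} (hK : 0 ≤ K) (hB : ∀ x y, ‖B x y‖ ≤ K * ‖x‖ * ‖y‖) :
    ∃ T : A →L[ℂ] Z, ‖T‖ ≤ K * C ^ 2 ∧
      ∀ a, Tendsto (fun F : Finset κ => ∑ k ∈ F, B (a * f k) (f k)) atTop (𝓝 (T a)) := by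
  choose t ht using fun a => cauchySeq_tendsto_of_complete (hf.cauchySeq_sum_bilinear B hK hB a)
  let T₀ : A →ₗ[ℂ] Z :=
    { toFun := t
      map_add' := fun a b => tendsto_nhds_unique (ht (a + b)) <| by
        simpa [add_mul, Finset.sum_add_distrib] using (ht a).add (ht b)
      map_smul' := fun c a => tendsto_nhds_unique (ht (c • a)) <| by
        simpa [smul_mul_assoc, Finset.smul_sum] using (ht a).const_smul c }
  refine ⟨T₀.mkContinuous (K * C ^ 2) fun a => ?_, ?_, ht⟩
  · exact le_of_tendsto (ht a).norm (Eventually.of_forall fun F => hf.norm_sum_bilinear_le B hK hB F a)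
  · exact LinearMap.mkContinuous_norm_le _ (by positivity) _

theorem tendsto_sum_mul (hf : IsDiagonalFamily f C) [CompleteSpace A] (a : A) :
    Tendsto (fun F : Finset κ => ∑ k ∈ F, a * f k * f k) atTop (𝓝 a) := by
  obtain ⟨T, -, hT⟩ := hf.exists_limit (ContinuousLinearMap.mul ℂ A) zero_le_one
    (fun x y => by simpa using norm_mul_le x y)
  simp only [ContinuousLinearMap.mul_apply'] at hT
  have : (T : A → A) = id := by
    refine T.continuous.ext_on hf.dense continuous_id ?_
    rintro d ⟨F₀, h0, h1⟩
    refine tendsto_nhds_unique (hT d) ?_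
    refine tendsto_const_nhds.congr' ?_
    filter_upwards [eventually_ge_atTop F₀] with F hF
    rw [id, ← Finset.sum_subset hF fun k _ hk => by simp [h0 k hk], h1]
  simpa [this] using hT a

end IsDiagonalFamily

end Averaging

/-! ### Left projectivity from a diagonal family -/

section Projectivity

variable {A : Type v} [NonUnitalNormedRing A] [NormedSpace ℂ A] [IsScalarTower ℂ A A]
  [SMulCommClass ℂ A A]

namespace ProjTensorSquare

omit [IsScalarTower ℂ A A] [SMulCommClass ℂ A A] in
theorem norm_tmul_le (b c : A) : ‖tmul b c‖ ≤ ‖b‖ * ‖c‖ := by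
  unfold tmul
  rw [UniformSpace.Completion.norm_coe]
  refine (PiTensorProduct.projectiveSeminorm_tprod_le _).trans_eq ?_
  simp [Fin.prod_univ_two]

omit [IsScalarTower ℂ A A] [SMulCommClass ℂ A A] in
theorem tmul_eq_update_zero (b b' c : A) : tmul b' c =
    ((PiTensorProduct.tprod ℂ (Function.update ![b, c] 0 b') : ⨂[ℂ] _ : Fin 2, A) :
      UniformSpace.Completion (⨂[ℂ] _ : Fin 2, A)) := by
  unfold tmul
  congr 2
  funext i
  fin_cases i <;> simp

omit [IsScalarTower ℂ A A] [SMulCommClass ℂ A A] in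
theorem tmul_eq_update_one (b c c' : A) : tmul b c' =
    ((PiTensorProduct.tprod ℂ (Function.update ![b, c] 1 c') : ⨂[ℂ] _ : Fin 2, A) :
      UniformSpace.Completion (⨂[ℂ] _ : Fin 2, A)) := by
  unfold tmul
  congr 2
  funext i
  fin_cases i <;> simp

variable (A) in
/-- The elementary tensor `b ⊗ c` as a bounded bilinear map. -/
def tmulL : A →L[ℂ] A →L[ℂ] ProjTensorSquare A :=
  LinearMap.mkContinuous₂
    (LinearMap.mk₂ ℂ tmul
      (fun b b' c => by
        rw [tmul_eq_update_zero b (b + b'), tmul_eq_update_zero b b, tmul_eq_update_zero b b',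
          MultilinearMap.map_update_add, UniformSpace.Completion.coe_add])
      (fun z b c => by
        rw [tmul_eq_update_zero b (z • b), tmul_eq_update_zero b b,
          MultilinearMap.map_update_smul, UniformSpace.Completion.coe_smul])
      (fun b c c' => by
        rw [tmul_eq_update_one b c (c + c'), tmul_eq_update_one b c c, tmul_eq_update_one b c c',
          MultilinearMap.map_update_add, UniformSpace.Completion.coe_add])
      (fun z b c => by
        rw [tmul_eq_update_one b c (z • c), tmul_eq_update_one b c c,
          MultilinearMap.map_update_smul, UniformSpace.Completion.coe_smul]))
    1 (fun b c => by simpa using norm_tmul_le b c)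

@[simp] theorem tmulL_apply (b c : A) : tmulL A b c = tmul b c := rfl

end ProjTensorSquare

variable {κ : Type*} {f : κ → A} {C : ℝ} [CompleteSpace A]

/-- `ρ a = ∑ (a f_k) ⊗ f_k`; the factor `a` stands leftmost in every partial sum, so `ρ` is a module
morphism. -/
theorem IsDiagonalFamily.exists_splitting (hf : IsDiagonalFamily f C) :
    ∃ ρ : A →L[ℂ] ProjTensorSquare A,
      (∀ a b : A, ρ (a * b) = ProjTensorSquare.leftMul a (ρ b)) ∧
      (∀ a : A, ProjTensorSquare.mulMap (ρ a) = a) ∧ ‖ρ‖ ≤ C ^ 2 := by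
  obtain ⟨ρ, hρ, h⟩ := hf.exists_limit (ProjTensorSquare.tmulL A) zero_le_one
    (fun x y => by simpa using ProjTensorSquare.norm_tmul_le x y)
  refine ⟨ρ, fun a b => tendsto_nhds_unique (h (a * b)) ?_, fun a => ?_, hρ.trans_eq ?_⟩
  · simpa [Function.comp_def, map_sum, ProjTensorSquare.leftMul_tmul, mul_assoc] using
      ((ProjTensorSquare.leftMul a).continuous.tendsto _).comp (h b)
  · refine tendsto_nhds_unique ?_ (hf.tendsto_sum_mul a)
    simpa [Function.comp_def, map_sum, ProjTensorSquare.mulMap_tmul] using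
      ((ProjTensorSquare.mulMap (A := A)).continuous.tendsto _).comp (h a)
  · rw [one_mul]

/-- `ψ a = ∑ (a f_k) · σ (f_k)`. Applying the morphism `φ` turns each term into `a f_k f_k`, as `φ ∘
σ = id`. -/
theorem IsDiagonalFamily.isLeftProjective (hf : IsDiagonalFamily f C) :
    IsLeftProjective.{v, w} A := by
  intro Y _ _ _ mY φ hφ ⟨σ, hσ⟩
  obtain ⟨ψ, -, h⟩ := hf.exists_limit
    ((ContinuousLinearMap.compL ℂ A Y Y).flip σ ∘L mY.act)
    (K := ‖mY.act‖ * ‖σ‖) (by positivity) (fun x y => by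
      calc ‖mY.act x (σ y)‖ ≤ ‖mY.act‖ * ‖x‖ * ‖σ y‖ := mY.act.le_opNorm₂ x (σ y)
        _ ≤ ‖mY.act‖ * ‖x‖ * (‖σ‖ * ‖y‖) := by gcongr; exact σ.le_opNorm y
        _ = ‖mY.act‖ * ‖σ‖ * ‖x‖ * ‖y‖ := by ring)
  simp only [ContinuousLinearMap.comp_apply, ContinuousLinearMap.flip_apply,
    ContinuousLinearMap.compL_apply] at h
  refine ⟨ψ, fun a b => tendsto_nhds_unique (h (a * b)) ?_, fun a => ?_⟩
  · simpa [Function.comp_def, map_sum, mY.mul_act, mul_assoc] using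
      ((mY.act a).continuous.tendsto _).comp (h b)
  · refine tendsto_nhds_unique ?_ (hf.tendsto_sum_mul a)
    have := (φ.continuous.tendsto _).comp (h a)
    simp only [Function.comp_def, map_sum, hφ _ _, hσ] at this
    exact this

end Projectivity

/-! ### Strictly positive elements generate the algebra as an ideal -/

section StrictlyPositive

variable {A : Type*} [NonUnitalCStarAlgebra A]

/-- The compression `x ↦ (1 - e) x (1 - e)`. -/
def compress (e : A) : A →ₗ[ℝ] A where
  toFun x := x - e * x - x * e + e * x * e
  map_add' x y := by simp only [mul_add, add_mul]; abel
  map_smul' c x := by simp only [mul_smul_comm, smul_mul_assoc, RingHom.id_apply]; module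

theorem compress_apply (e x : A) : compress e x = x - e * x - x * e + e * x * e := rfl

/-- Shows that compression preserves positivity, although `1 - e` need not lie in `A`. -/
theorem compress_star_mul_self {e : A} (he : IsSelfAdjoint e) (b : A) :
    compress e (star b * b) = star (b - b * e) * (b - b * e) := by
  rw [compress_apply, star_sub, star_mul, he.star_eq]
  noncomm_ring

theorem norm_compress_le {e : A} (he : ‖e‖ ≤ 1) (x : A) : ‖compress e x‖ ≤ 4 * ‖x‖ := by
  have h1 : ‖e * x‖ ≤ ‖x‖ := (norm_mul_le _ _).trans (mul_le_of_le_one_left (norm_nonneg _) he)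
  have h2 : ‖x * e‖ ≤ ‖x‖ := (norm_mul_le _ _).trans (mul_le_of_le_one_right (norm_nonneg _) he)
  have h3 : ‖e * x * e‖ ≤ ‖e * x‖ :=
    (norm_mul_le _ _).trans (mul_le_of_le_one_right (norm_nonneg _) he)
  rw [compress_apply]
  linarith [norm_add_le (x - e * x - x * e) (e * x * e), norm_sub_le (x - e * x) (x * e),
    norm_sub_le x (e * x)]

theorem norm_compress_le_of_mul_right {e : A} (he : ‖e‖ ≤ 1) (x : A) :
    ‖compress e x‖ ≤ 2 * ‖x - x * e‖ := by
  have h1 : ‖e * (x - x * e)‖ ≤ ‖x - x * e‖ :=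
    (norm_mul_le _ _).trans (mul_le_of_le_one_left (norm_nonneg _) he)
  have : compress e x = (x - x * e) - e * (x - x * e) := by
    rw [compress_apply]; noncomm_ring
  rw [this]
  linarith [norm_sub_le (x - x * e) (e * (x - x * e))]

/-- The complex functional whose real part is `x ↦ g (Re x)`. -/
theorem exists_complex_functional (g : A →ₗ[ℝ] ℝ) :
    ∃ F : A →ₗ[ℂ] ℂ, ∀ x : A, IsSelfAdjoint x → F x = g x := by
  let r : A →ₗ[ℝ] A :=
    { toFun := fun x => (realPart x : A)
      map_add' := fun x y => by simp
      map_smul' := fun c x => by simp }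
  refine ⟨Module.Dual.extendRCLike (𝕜 := ℂ) (g ∘ₗ r), fun x hx => ?_⟩
  have h1 : r x = x := hx.coe_realPart
  have h2 : r (Complex.I • x) = 0 := by
    simp [r, realPart_I_smul, hx.imaginaryPart]
  rw [Module.Dual.extendRCLike_apply]
  simp [h1, h2]

attribute [local instance] CStarAlgebra.spectralOrder CStarAlgebra.spectralOrderedRing in
/-- If `h` is strictly positive and `h = lim h eₙ`, then no element stays away from its products with
the `eₙ`. -/
theorem IsStrictlyPositiveElement.exists_norm_sub_mul_lt {h : A} (hh : IsStrictlyPositiveElement h)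
    {e : ℕ → A} (he : ∀ n, IsSelfAdjoint (e n)) (he1 : ∀ n, ‖e n‖ ≤ 1)
    (hlim : Tendsto (fun n => ‖h - h * e n‖) atTop (𝓝 0)) (a : A) {ε : ℝ} (hε : 0 < ε) :
    ∃ n, ‖a - a * e n‖ < ε := by
  by_contra! hcon
  have hδ : ∀ n, ε ^ 2 ≤ ‖compress (e n) (star a * a)‖ := fun n => by
    rw [compress_star_mul_self (he n), CStarRing.norm_star_mul_self, ← sq]
    gcongr
    exact hcon n
  -- The cone `ℝ h - A₊`. Strict positivity of `h` is contradicted by a functional separating `star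
  -- a * a` from it.
  let K : Set A := {x | ∃ (c : ℝ) (y : A), 0 ≤ y ∧ x = c • h - y}
  have hK : Convex ℝ K := by
    rintro _ ⟨c, y, hy, rfl⟩ _ ⟨c', y', hy', rfl⟩ s t hs ht -
    exact ⟨s * c + t * c', s • y + t • y', add_nonneg (smul_nonneg hs hy) (smul_nonneg ht hy'),
      by module⟩
  -- Compression costs a factor `4`, so an error `ε ^ 2 / 8` uses up only half of the lower bound `ε
  -- ^ 2`, while the compressions of `c • h` tend to `0`.
  have hdisj : Disjoint (Metric.ball (star a * a) (ε ^ 2 / 8)) K := by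
    rw [Set.disjoint_left]
    rintro _ hx ⟨c, y, hy, rfl⟩
    rw [Metric.mem_ball, dist_comm, dist_eq_norm] at hx
    have key : ∀ n, ε ^ 2 / 2 ≤ |c| * (2 * ‖h - h * e n‖) := by
      intro n
      have hmono : ‖compress (e n) (star a * a)‖ ≤ ‖compress (e n) (star a * a + y)‖ := by
        obtain ⟨b, rfl⟩ := CStarAlgebra.nonneg_iff_eq_star_mul_self.1 hy
        rw [map_add, compress_star_mul_self (he n), compress_star_mul_self (he n)]
        exact CStarAlgebra.norm_le_norm_of_nonneg_of_le (star_mul_self_nonneg _)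
          (le_add_of_nonneg_right (star_mul_self_nonneg _))
      have e1 : star a * a + y = (star a * a - (c • h - y)) + c • h := by abel
      have h1 := norm_compress_le (he1 n) (star a * a - (c • h - y))
      have h2 := norm_compress_le_of_mul_right (he1 n) h
      rw [e1, map_add, map_smul] at hmono
      have h3 := norm_add_le (compress (e n) (star a * a - (c • h - y))) (c • compress (e n) h)
      rw [norm_smul, Real.norm_eq_abs] at h3
      have h4 : |c| * ‖compress (e n) h‖ ≤ |c| * (2 * ‖h - h * e n‖) := by gcongr
      linarith [hδ n]
    have := ge_of_tendsto ((hlim.const_mul 2).const_mul |c|) (Eventually.of_forall key)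
    simp only [mul_zero] at this
    have : 0 < ε ^ 2 := by positivity
    linarith
  obtain ⟨f, u, hf1, hf2⟩ := geometric_hahn_banach_open (convex_ball _ _) Metric.isOpen_ball hK hdisj
  have hu : u ≤ 0 := by simpa using hf2 0 ⟨0, 0, le_rfl, by simp⟩
  have hfa : f (star a * a) < 0 :=
    (hf1 _ (Metric.mem_ball_self (by positivity))).trans_le hu
  -- A functional bounded below on a cone is non-negative there. Hence `-f` is positive, and it
  -- vanishes at `h` because `K` contains both `h` and `-h`.
  have cone : ∀ x ∈ K, 0 ≤ f x := by
    rintro _ ⟨c, y, hy, rfl⟩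
    by_contra! hneg
    obtain ⟨n, hn⟩ := exists_nat_gt (u / f (c • h - y))
    rw [div_lt_iff_of_neg hneg] at hn
    have := hf2 ((n : ℝ) • (c • h - y)) ⟨n * c, (n : ℝ) • y, smul_nonneg (by positivity) hy,
      by module⟩
    rw [map_smul, smul_eq_mul] at this
    linarith
  have hpos : ∀ y : A, 0 ≤ y → f y ≤ 0 := fun y hy => by
    have := cone (-y) ⟨0, y, hy, by simp⟩
    rw [map_neg] at this
    linarith
  have hh0 : f h = 0 := by
    have h1 := cone h ⟨1, 0, le_rfl, by simp⟩
    have h2 := cone (-h) ⟨-1, 0, le_rfl, by simp⟩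
    rw [map_neg] at h2
    linarith
  obtain ⟨F, hF⟩ := exists_complex_functional (-f : A →L[ℝ] ℝ).toLinearMap
  have hFr : ∀ x : A, IsSelfAdjoint x → F x = ((-f x : ℝ) : ℂ) := fun x hx => by
    simpa using hF x hx
  have hhs : IsSelfAdjoint h := by
    obtain ⟨b, rfl⟩ := hh.1
    exact IsSelfAdjoint.star_mul_self b
  refine absurd (hh.2 F (fun b => ?_) fun h0 => ?_) ?_
  · rw [hFr _ (IsSelfAdjoint.star_mul_self b)]
    simpa using hpos _ (star_mul_self_nonneg b)
  · have := hFr _ (IsSelfAdjoint.star_mul_self a)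
    rw [h0, LinearMap.zero_apply, eq_comm, Complex.ofReal_eq_zero] at this
    linarith
  · rw [hFr _ hhs, hh0]
    simp

theorem IsStrictlyPositiveElement.isSelfAdjoint {h : A} (hh : IsStrictlyPositiveElement h) :
    IsSelfAdjoint h := by
  obtain ⟨b, rfl⟩ := hh.1
  exact IsSelfAdjoint.star_mul_self b

theorem IsStrictlyPositiveElement.map {B : Type*} [NonUnitalCStarAlgebra B] {h : A}
    (hh : IsStrictlyPositiveElement h) (φ : A ≃⋆ₐ[ℂ] B) : IsStrictlyPositiveElement (φ h) := by
  obtain ⟨⟨b, hb⟩, h2⟩ := hh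
  refine ⟨⟨φ b, by rw [hb, map_mul, map_star]⟩, fun f hf hf0 => ?_⟩
  refine h2 (f ∘ₗ (φ : A →ₗ[ℂ] B)) (fun b => ?_) fun h0 => hf0 ?_
  · simpa [map_mul, map_star] using hf (φ b)
  · ext x
    simpa using LinearMap.congr_fun h0 (φ.symm x)

attribute [local instance] CStarAlgebra.spectralOrder CStarAlgebra.spectralOrderedRing in
-- Terms with coefficient zero are unconstrained: in a gluing, each local section is strictly
-- positive only on its own open set.
theorem IsStrictlyPositiveElement.sum {ι : Type*} (s : Finset ι) (c : ι → ℝ) (h : ι → A)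
    (hc : ∀ i ∈ s, 0 ≤ c i) (hh : ∀ i ∈ s, c i ≠ 0 → IsStrictlyPositiveElement (h i))
    (hne : ∃ i ∈ s, c i ≠ 0) : IsStrictlyPositiveElement (∑ i ∈ s, (c i : ℂ) • h i) := by
  refine ⟨CStarAlgebra.nonneg_iff_eq_star_mul_self.1 (Finset.sum_nonneg fun i hi => ?_),
    fun f hf hf0 => ?_⟩
  · by_cases h0 : c i = 0
    · simp [h0]
    · rw [Complex.coe_smul]
      exact smul_nonneg (hc i hi) (CStarAlgebra.nonneg_iff_eq_star_mul_self.2 (hh i hi h0).1)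
  · rw [map_sum, Complex.re_sum]
    have key : ∀ i ∈ s, c i ≠ 0 → 0 < (f ((c i : ℂ) • h i)).re := fun i hi h0 => by
      rw [map_smul, smul_eq_mul, Complex.re_ofReal_mul]
      exact mul_pos ((hc i hi).lt_of_ne' h0) ((hh i hi h0).2 f hf hf0)
    refine Finset.sum_pos' (fun i hi => ?_) ?_
    · by_cases h0 : c i = 0
      · simp [h0]
      · exact (key i hi h0).le
    · obtain ⟨i, hi, h0⟩ := hne
      exact ⟨i, hi, key i hi h0⟩

end StrictlyPositive

/-! ### Cut-off functions on the line -/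

section Cutoff

/-- Even continuous cut-offs increasing to `1` away from `0`: `cutoff (n + 1)` vanishes for
`|s| ≤ 2⁻ⁿ` and is `1` for `|s| ≥ 2⁻ⁿ⁺¹`. -/
def cutoff : ℕ → ℝ → ℝ
  | 0, _ => 0
  | n + 1, s => max 0 (min 1 (2 ^ n * |s| - 1))

/-- The square root of the difference of two consecutive cut-offs. -/
def cutoffSqrt (k : ℕ) (s : ℝ) : ℝ := √(cutoff (k + 1) s - cutoff k s)

@[fun_prop] theorem continuous_cutoff (n : ℕ) : Continuous (cutoff n) := by
  cases n with
  | zero => exact continuous_const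
  | succ n => unfold cutoff; fun_prop

@[fun_prop] theorem continuous_cutoffSqrt (n : ℕ) : Continuous (cutoffSqrt n) := by
  unfold cutoffSqrt; fun_prop

@[simp] theorem cutoff_apply_zero (n : ℕ) : cutoff n 0 = 0 := by
  cases n <;> simp [cutoff]

@[simp] theorem cutoffSqrt_apply_zero (n : ℕ) : cutoffSqrt n 0 = 0 := by simp [cutoffSqrt]

theorem cutoff_nonneg (n : ℕ) (s : ℝ) : 0 ≤ cutoff n s := by
  cases n <;> simp [cutoff]

theorem cutoff_le_one (n : ℕ) (s : ℝ) : cutoff n s ≤ 1 := by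
  cases n <;> simp [cutoff]

/-- Each cut-off is already `1` on the set where the previous one is non-zero. The product and
support relations below rest on this nesting. -/
theorem cutoff_succ_eq_one {n : ℕ} {s : ℝ} (h : cutoff n s ≠ 0) : cutoff (n + 1) s = 1 := by
  cases n with
  | zero => simp [cutoff] at h
  | succ n =>
    have h1 : 1 < 2 ^ n * |s| := by
      by_contra! h1
      exact h (max_eq_left (min_le_of_right_le (by linarith)))
    have h2 : (1 : ℝ) ≤ 2 ^ (n + 1) * |s| - 1 := by rw [pow_succ]; linarith
    simp [cutoff, min_eq_left h2]

theorem cutoff_eq_one_of_lt {n m : ℕ} (hnm : n < m) {s : ℝ} (h : cutoff n s ≠ 0) :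
    cutoff m s = 1 := by
  induction m, hnm using Nat.le_induction with
  | base => exact cutoff_succ_eq_one h
  | succ m _ ih => exact cutoff_succ_eq_one (by rw [ih]; exact one_ne_zero)

theorem cutoff_mono_succ (n : ℕ) (s : ℝ) : cutoff n s ≤ cutoff (n + 1) s := by
  by_cases h : cutoff n s = 0
  · rw [h]; exact cutoff_nonneg _ _
  · rw [cutoff_succ_eq_one h]; exact cutoff_le_one _ _

theorem cutoff_mul_cutoff {n m : ℕ} (hnm : n < m) (s : ℝ) :
    cutoff n s * cutoff m s = cutoff n s := by
  by_cases h : cutoff n s = 0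
  · simp [h]
  · rw [cutoff_eq_one_of_lt hnm h, mul_one]

theorem cutoff_mul_cutoffSqrt {n k : ℕ} (hnk : n < k) (s : ℝ) :
    cutoff n s * cutoffSqrt k s = 0 := by
  by_cases h : cutoff n s = 0
  · simp [h]
  · simp [cutoffSqrt, cutoff_eq_one_of_lt hnk h, cutoff_eq_one_of_lt (hnk.trans k.lt_succ_self) h]

theorem abs_mul_one_sub_cutoff_le (n : ℕ) (s : ℝ) :
    |s - s * cutoff (n + 1) s| ≤ 2 * (1 / 2) ^ n := by
  rw [← mul_one_sub, abs_mul, abs_of_nonneg (sub_nonneg.2 (cutoff_le_one _ _))]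
  have h2 : (0 : ℝ) < 2 ^ n := by positivity
  rcases le_or_gt 2 (2 ^ n * |s|) with h | h
  · have : (1 : ℝ) ≤ 2 ^ n * |s| - 1 := by linarith
    simp [cutoff, min_eq_left this]
  · calc |s| * (1 - cutoff (n + 1) s) ≤ |s| * 1 := by
          gcongr; linarith [cutoff_nonneg (n + 1) s]
      _ ≤ 2 * (1 / 2) ^ n := by
        rw [mul_one, one_div, inv_pow, ← div_eq_mul_inv, le_div_iff₀ h2, mul_comm]
        exact h.le

theorem cutoffSqrt_nonneg (k : ℕ) (s : ℝ) : 0 ≤ cutoffSqrt k s := Real.sqrt_nonneg _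

theorem cutoffSqrt_le_one (k : ℕ) (s : ℝ) : cutoffSqrt k s ≤ 1 := by
  rw [cutoffSqrt, Real.sqrt_le_one]
  linarith [cutoff_nonneg k s, cutoff_le_one (k + 1) s]

theorem cutoffSqrt_mul_self (k : ℕ) (s : ℝ) :
    cutoffSqrt k s * cutoffSqrt k s = cutoff (k + 1) s - cutoff k s :=
  Real.mul_self_sqrt (sub_nonneg.2 (cutoff_mono_succ k s))

theorem exists_cutoffSqrt_support (s : ℝ) :
    ∃ i j : ℕ, ∀ k, cutoffSqrt k s ≠ 0 → k = i ∨ k = j := by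
  by_cases h : ∃ n, cutoff n s ≠ 0
  · classical
    obtain ⟨hn, hmin⟩ := And.intro (Nat.find_spec h) (fun m => Nat.find_min h (m := m))
    set n := Nat.find h
    have hn0 : n ≠ 0 := fun h0 => by simp [h0, cutoff] at hn
    -- `n` is the first index with a non-zero cut-off: for `k + 1 < n` both cut-offs in the
    -- difference vanish, for `k > n` both equal `1`.
    refine ⟨n - 1, n, fun k hk => ?_⟩
    by_contra! hne
    rcases Nat.lt_or_ge n k with h1 | h1
    · exact hk (by simpa [hn] using cutoff_mul_cutoffSqrt h1 s)
    · have h2 : k + 1 < n := by omega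
      have h3 := hmin _ h2
      have h4 := hmin _ (k.lt_succ_self.trans h2)
      push Not at h3 h4
      simp [cutoffSqrt, h3, h4] at hk
  · push Not at h
    exact ⟨0, 0, fun k hk => absurd (by simp [cutoffSqrt, h]) hk⟩

/-- A family of reals in `[0, 1]`, at most two of which are non-zero, has sum at most `2`. -/
theorem sum_le_two {ι : Type*} {x : ι → ℝ} (h0 : ∀ i, 0 ≤ x i) (h1 : ∀ i, x i ≤ 1)
    (h2 : ∃ i j, ∀ k, x k ≠ 0 → k = i ∨ k = j) (F : Finset ι) : ∑ i ∈ F, x i ≤ 2 := by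
  classical
  obtain ⟨i, j, h⟩ := h2
  calc ∑ k ∈ F, x k ≤ ∑ k ∈ F ∪ {i, j}, x k :=
        Finset.sum_le_sum_of_subset_of_nonneg Finset.subset_union_left fun k _ _ => h0 k
    _ = ∑ k ∈ {i, j}, x k :=
        (Finset.sum_subset Finset.subset_union_right fun k _ hk => by
          by_contra hne
          exact hk (by simpa using h k hne)).symm
    _ ≤ ∑ k ∈ ({i, j} : Finset ι), 1 := Finset.sum_le_sum fun k _ => h1 k
    _ ≤ 2 := by
        rw [Finset.sum_const, nsmul_eq_mul, mul_one]
        exact_mod_cast Finset.card_le_two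

/-! ### Cut-offs of an element, by functional calculus -/

variable {A : Type*} [NonUnitalCStarAlgebra A]

theorem norm_cutoff_le (n : ℕ) (h : A) : ‖cfcₙ (cutoff n) h‖ ≤ 1 :=
  norm_cfcₙ_le fun s _ => by
    rw [Real.norm_of_nonneg (cutoff_nonneg n s)]; exact cutoff_le_one n s

theorem cfcₙ_cutoff_mul_cutoff {n m : ℕ} (hnm : n < m) (h : A) :
    cfcₙ (cutoff n) h * cfcₙ (cutoff m) h = cfcₙ (cutoff n) h := by
  rw [← cfcₙ_mul ..]
  simp_rw [cutoff_mul_cutoff hnm]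

theorem cfcₙ_cutoff_mul_cutoffSqrt {n k : ℕ} (hnk : n < k) (h : A) :
    cfcₙ (cutoff n) h * cfcₙ (cutoffSqrt k) h = 0 := by
  rw [← cfcₙ_mul ..]
  simp_rw [cutoff_mul_cutoffSqrt hnk]
  exact cfcₙ_const_zero ℝ h

theorem sum_cfcₙ_cutoffSqrt_sq (n : ℕ) (h : A) :
    ∑ k ∈ Finset.range n, cfcₙ (cutoffSqrt k) h * cfcₙ (cutoffSqrt k) h = cfcₙ (cutoff n) h := by
  have h0 : cfcₙ (cutoff 0) h = 0 := cfcₙ_const_zero ℝ h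
  rw [← sub_zero (cfcₙ (cutoff n) h), ← h0,
    ← Finset.sum_range_sub (fun k => cfcₙ (cutoff k) h) n]
  refine Finset.sum_congr rfl fun k _ => ?_
  rw [← cfcₙ_mul .., ← cfcₙ_sub ..]
  simp_rw [cutoffSqrt_mul_self]

theorem norm_sum_cutoffSqrt_le (h : A) (hs : IsSelfAdjoint h) (F : Finset ℕ) (ε : ℕ → ℂ)
    (hε : ∀ k, ‖ε k‖ ≤ 1) : ‖∑ k ∈ F, ε k • cfcₙ (cutoffSqrt k) h‖ ≤ 2 := by
  have hn : IsStarNormal h := hs.isStarNormal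
  -- The complex coefficients force a passage to the complex functional calculus. The norm is then
  -- controlled pointwise on the spectrum, where at most two terms survive.
  have e : ∀ k, ε k • cfcₙ (cutoffSqrt k) h =
      cfcₙ (fun z : ℂ => ε k * (cutoffSqrt k z.re : ℂ)) h := fun k => by
    rw [cfcₙ_real_eq_complex _ hs, ← cfcₙ_smul (ε k) _ h (by fun_prop) (by simp)]
    rfl
  simp_rw [e]
  rw [← cfcₙ_sum _ h F (fun k _ => by fun_prop) (by simp)]
  refine norm_cfcₙ_le fun z _ => ?_
  rw [Finset.sum_apply]
  refine (norm_sum_le_of_le F fun k _ => ?_).trans (sum_le_two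
    (fun k => cutoffSqrt_nonneg k z.re) (fun k => cutoffSqrt_le_one k z.re)
    (exists_cutoffSqrt_support z.re) F)
  rw [norm_mul, Complex.norm_real, Real.norm_of_nonneg (cutoffSqrt_nonneg k z.re)]
  exact mul_le_of_le_one_left (cutoffSqrt_nonneg k z.re) (hε k)

theorem IsStrictlyPositiveElement.exists_norm_sub_mul_cutoff_lt {h : A}
    (hh : IsStrictlyPositiveElement h) (a : A) {ε : ℝ} (hε : 0 < ε) :
    ∃ n, ‖a - a * cfcₙ (cutoff n) h‖ < ε := by
  have hs := hh.isSelfAdjoint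
  suffices hlim : Tendsto (fun n => ‖h - h * cfcₙ (cutoff (n + 1)) h‖) atTop (𝓝 0) by
    obtain ⟨n, hn⟩ := hh.exists_norm_sub_mul_lt (e := fun n => cfcₙ (cutoff (n + 1)) h)
      (fun n => cfcₙ_predicate _ h) (fun n => norm_cutoff_le _ h) hlim a hε
    exact ⟨n + 1, hn⟩
  refine squeeze_zero (g := fun n : ℕ => 2 * (1 / 2 : ℝ) ^ n) (fun _ => norm_nonneg _)
    (fun n => ?_) ?_
  · have : h - h * cfcₙ (cutoff (n + 1)) h = cfcₙ (fun s : ℝ => s - s * cutoff (n + 1) s) h := by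
      conv_lhs => rw [← cfcₙ_id' ℝ h]
      rw [cfcₙ_sub .., cfcₙ_mul .., cfcₙ_id' ℝ h]
    rw [this]
    exact norm_cfcₙ_le fun s _ => abs_mul_one_sub_cutoff_le n s
  · simpa using (tendsto_pow_atTop_nhds_zero_of_lt_one (r := (1 / 2 : ℝ)) (by norm_num)
      (by norm_num)).const_mul 2

end Cutoff

/-! ### Partitions of unity of multiplicity two -/

section Topology

/-- Each vertex of a sphere has a neighbour in the preceding sphere. The spheres serve as the finite
blocks into which the partition of unity is regrouped. -/
theorem SimpleGraph.finite_setOf_reachable_dist_eq {V : Type*} (G : SimpleGraph V)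
    (hG : ∀ v, (G.neighborSet v).Finite) (o : V) (n : ℕ) :
    {v | G.Reachable o v ∧ G.dist o v = n}.Finite := by
  induction n with
  | zero =>
    refine (Set.finite_singleton o).subset ?_
    rintro v ⟨hr, hd⟩
    exact (hr.dist_eq_zero_iff.1 hd).symm
  | succ n ih =>
    refine (ih.biUnion fun v _ => hG v).subset ?_
    rintro v ⟨hr, hd⟩
    obtain ⟨p, hp⟩ := hr.symm.exists_walk_length_eq_dist
    rw [SimpleGraph.dist_comm, hd] at hp
    cases p with
    | nil => simp at hp
    | @cons _ w _ hadj p =>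
      simp only [SimpleGraph.Walk.length_cons, add_left_inj] at hp
      refine Set.mem_biUnion (x := w) ⟨p.reachable.symm, ?_⟩ hadj.symm
      have h1 : G.dist o w ≤ n := by
        rw [SimpleGraph.dist_comm, ← hp]; exact SimpleGraph.dist_le p
      have h2 := hadj.symm.diff_dist_adj (u := o)
      omega

/-- A locally compact paracompact Hausdorff space has a locally finite partition of unity by compactly
supported functions, at most two of which are non-zero at any point. -/
theorem exists_partitionOfUnity_multiplicity_two (Ω : Type u) [TopologicalSpace Ω] [T2Space Ω]
    [LocallyCompactSpace Ω] [ParacompactSpace Ω] :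
    ∃ (ι : Type u) (θ : PartitionOfUnity ι Ω univ), (∀ i, HasCompactSupport (θ i)) ∧
      ∀ t, ∃ i j, ∀ k, θ k t ≠ 0 → k = i ∨ k = j := by
  classical
  choose N hN hNt using fun t : Ω => exists_compact_mem_nhds t
  obtain ⟨ψ, hψ⟩ := PartitionOfUnity.exists_isSubordinate (isClosed_univ (X := Ω))
    (fun t => interior (N t)) (fun _ => isOpen_interior)
    (fun t _ => mem_iUnion.2 ⟨t, mem_interior_iff_mem_nhds.2 (hNt t)⟩)
  have hcpt : ∀ i, HasCompactSupport (ψ i) := fun i =>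
    (hN i).of_isClosed_subset (isClosed_tsupport _) ((hψ i).trans interior_subset)
  -- Two indices are adjacent when their functions are non-zero at a common point; compact supports
  -- make this graph locally finite.
  let G : SimpleGraph Ω := SimpleGraph.fromRel fun i j => ∃ t, ψ i t ≠ 0 ∧ ψ j t ≠ 0
  have hG : ∀ i, (G.neighborSet i).Finite := fun i => by
    refine (ψ.locallyFinite.finite_nonempty_inter_compact (hcpt i)).subset ?_
    rintro j ⟨-, h | h⟩
    · obtain ⟨t, h1, h2⟩ := h
      exact ⟨t, h2, subset_tsupport _ h1⟩
    · obtain ⟨t, h1, h2⟩ := h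
      exact ⟨t, h1, subset_tsupport _ h2⟩
  -- Indices are grouped by component and by distance to a chosen root of it.
  let r : Ω → G.ConnectedComponent × ℕ := fun i =>
    (G.connectedComponentMk i, G.dist (G.connectedComponentMk i).out i)
  have hreach : ∀ i, G.Reachable (G.connectedComponentMk i).out i := fun i =>
    SimpleGraph.ConnectedComponent.exact (Quot.out_eq _)
  have hfin : ∀ κ, {i | r i = κ}.Finite := fun κ => by
    refine (G.finite_setOf_reachable_dist_eq hG κ.1.out κ.2).subset ?_
    rintro i rfl
    exact ⟨hreach i, rfl⟩
  -- Functions non-zero at the same point lie in one component, in equal or consecutive layers.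
  have hnear : ∀ i j t, ψ i t ≠ 0 → ψ j t ≠ 0 → (r i).1 = (r j).1 ∧ (r i).2 ≤ (r j).2 + 1 := by
    intro i j t hi hj
    by_cases hij : i = j
    · subst hij; simp
    have hadj : G.Adj i j := ⟨hij, Or.inl ⟨t, hi, hj⟩⟩
    have hc : G.connectedComponentMk i = G.connectedComponentMk j :=
      SimpleGraph.ConnectedComponent.sound hadj.reachable
    refine ⟨hc, ?_⟩
    have h2 := hadj.symm.diff_dist_adj (u := (G.connectedComponentMk j).out)
    simp only [r, hc]
    omega
  let θ : G.ConnectedComponent × ℕ → C(Ω, ℝ) := fun κ => ∑ i ∈ (hfin κ).toFinset, ψ i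
  have hθ : ∀ κ t, θ κ t = ∑ i ∈ (hfin κ).toFinset, ψ i t := fun κ t => by simp [θ]
  have hne : ∀ κ t, θ κ t ≠ 0 → ∃ i, r i = κ ∧ ψ i t ≠ 0 := fun κ t h => by
    rw [hθ] at h
    obtain ⟨i, hi, hi'⟩ := Finset.exists_ne_zero_of_sum_ne_zero h
    exact ⟨i, by simpa using hi, hi'⟩
  have hsum : ∀ t, ∑ᶠ κ, θ κ t = 1 := fun t => by
    have hft : (Function.support fun i => ψ i t).Finite := ψ.locallyFinite.point_finite t
    rw [← ψ.sum_eq_one (mem_univ t), finsum_eq_sum _ hft,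
      finsum_eq_sum_of_support_subset (s := hft.toFinset.image r)]
    · rw [← Finset.sum_fiberwise_of_maps_to (g := r) (t := hft.toFinset.image r)
        (fun i hi => Finset.mem_image_of_mem r hi)]
      refine Finset.sum_congr rfl fun κ _ => ?_
      rw [hθ]
      refine (Finset.sum_subset (fun i hi => ?_) fun i hi hi' => ?_).symm
      · simpa using (Finset.mem_filter.1 hi).2
      · by_contra h0
        exact hi' (Finset.mem_filter.2 ⟨by simpa using h0, by simpa using hi⟩)
    · intro κ hκ
      obtain ⟨i, rfl, hi⟩ := hne κ t hκ
      simp only [Finset.coe_image, Set.mem_image]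
      exact ⟨i, by simpa using hi, rfl⟩
  refine ⟨G.ConnectedComponent × ℕ,
    { toFun := θ
      locallyFinite' := fun t => ?_
      nonneg' := fun κ t => by
        change 0 ≤ θ κ t
        rw [hθ]; exact Finset.sum_nonneg fun i _ => ψ.nonneg i t
      sum_eq_one' := fun t _ => hsum t
      sum_le_one' := fun t => (hsum t).le }, fun κ => ?_, fun t => ?_⟩
  · obtain ⟨W, hW, hf⟩ := ψ.locallyFinite t
    refine ⟨W, hW, (hf.image r).subset ?_⟩
    rintro κ ⟨s, hs, hsW⟩
    obtain ⟨i, rfl, hi⟩ := hne κ s hs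
    exact ⟨i, ⟨s, hi, hsW⟩, rfl⟩
  · refine HasCompactSupport.intro
      ((hfin κ).isCompact_biUnion fun i _ => (hcpt i)) fun t ht => ?_
    by_contra h0
    obtain ⟨i, hi, hi'⟩ := hne κ t h0
    exact ht (mem_biUnion hi (subset_tsupport _ hi'))
  -- If `n` is the lowest layer active at `t`, only layers `n` and `n + 1` of that component can be
  -- active.
  · by_cases h : ∃ n, ∃ κ : G.ConnectedComponent × ℕ, θ κ t ≠ 0 ∧ κ.2 = n
    · obtain ⟨⟨κ, hκ, hκn⟩, hmin⟩ := And.intro (Nat.find_spec h) (fun m => Nat.find_min h (m := m))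
      refine ⟨κ, (κ.1, κ.2 + 1), fun κ' hκ' => ?_⟩
      obtain ⟨i, hi, hi'⟩ := hne κ t hκ
      obtain ⟨j, hj, hj'⟩ := hne κ' t hκ'
      obtain ⟨h1, h2⟩ := hnear j i t hj' hi'
      rw [hi, hj] at h1 h2
      have h3 : ¬ κ'.2 < κ.2 := fun hlt => hmin κ'.2 (hκn ▸ hlt) ⟨κ', hκ', rfl⟩
      rcases eq_or_ne κ'.2 κ.2 with h4 | h4
      · exact Or.inl (Prod.ext h1 h4)
      · exact Or.inr (Prod.ext h1 (by simp only; omega))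
    · push Not at h
      have h0 : ∀ κ, θ κ t = 0 := fun κ => by_contra fun hκ => h κ.2 κ hκ rfl
      simpa [h0] using hsum t

end Topology

/-! ### Sections of continuous fields -/

/-- The functional calculus in a closed subalgebra, evaluated under a family of `*`-homomorphisms. -/
theorem NonUnitalStarSubalgebra.exists_map_eq_cfcₙ {M : Type*} [NonUnitalCStarAlgebra M]
    (S : NonUnitalStarSubalgebra ℂ M) [IsClosed (S : Set M)] {a : M} (ha : a ∈ S)
    (hsa : IsSelfAdjoint a) {g : ℝ → ℝ} (hg : Continuous g) (hg0 : g 0 = 0) {ι : Type*}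
    {N : ι → Type*} [∀ i, NonUnitalCStarAlgebra (N i)] (φ : ∀ i, M →⋆ₙₐ[ℂ] N i) :
    ∃ b ∈ S, ∀ i, φ i b = cfcₙ g (φ i a) :=
  ⟨cfcₙ g a, cfcₙ_mem (𝕜' := ℂ) g ha, fun i =>
    NonUnitalStarAlgHom.map_cfcₙ (φ i) g a hg.continuousOn hg0
      (AddMonoidHomClass.continuous_of_bound (φ i) 1 fun x => by
        simpa using NonUnitalStarAlgHom.norm_apply_le (φ i) x) hsa
      (hsa.map (φ i))⟩

namespace ContinuousField

variable {Ω : Type u} [TopologicalSpace Ω] {A : Ω → Type v} [∀ t, NonUnitalCStarAlgebra (A t)]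

/-- A continuous vector field over an open set, multiplied by a continuous function supported in that
set, is a continuous vector field over the whole space. -/
theorem smul_mem_of_tsupport_subset (U : ContinuousField A) {V : Set Ω} (hV : IsOpen V)
    {x : ∀ t, A t} (hx : (fun s : V => x s) ∈ (U.restrict V).Θ) {c : Ω → ℂ} (hc : Continuous c)
    (hcV : tsupport c ⊆ V) : (fun t => c t • x t) ∈ U.Θ := by
  refine U.mem_of_locally_approx _ fun t ε hε => ?_
  by_cases ht : t ∈ tsupport c
  · have hct : (0 : ℝ) < ‖c t‖ + 1 := by positivity
    obtain ⟨x', hx', h⟩ := hx ⟨t, hcV ht⟩ (ε / 2 / (‖c t‖ + 1)) (by positivity)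
    have h : ∀ᶠ s in 𝓝 t, ‖x s - x' s‖ ≤ ε / 2 / (‖c t‖ + 1) := by
      rwa [← hV.isOpenEmbedding_subtypeVal.map_nhds_eq ⟨t, hcV ht⟩, eventually_map]
    have hxt : (0 : ℝ) < ‖x' t‖ + 1 := by positivity
    refine ⟨c t • x', SMulMemClass.smul_mem _ hx', ?_⟩
    filter_upwards [h, hc.norm.continuousAt.eventually_lt_const (lt_add_one ‖c t‖),
      (U.continuous_norm x' hx').continuousAt.eventually_lt_const (lt_add_one ‖x' t‖),
      (Metric.tendsto_nhds.1 hc.continuousAt) (ε / 2 / (‖x' t‖ + 1)) (by positivity)]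
      with s h1 h2 h3 h4
    rw [dist_eq_norm] at h4
    have e : c s • x s - (c t • x') s = c s • (x s - x' s) + (c s - c t) • x' s := by
      rw [Pi.smul_apply]; module
    rw [e]
    calc _ ≤ ‖c s‖ * ‖x s - x' s‖ + ‖c s - c t‖ * ‖x' s‖ := by
          simpa only [norm_smul] using norm_add_le (c s • (x s - x' s)) ((c s - c t) • x' s)
      _ ≤ (‖c t‖ + 1) * (ε / 2 / (‖c t‖ + 1)) + ε / 2 / (‖x' t‖ + 1) * (‖x' t‖ + 1) := by
          gcongr
      _ = ε := by field_simp; ring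
  · refine ⟨0, zero_mem _, ?_⟩
    filter_upwards [(isClosed_tsupport c).isOpen_compl.mem_nhds ht] with s hs
    simp [image_eq_zero_of_notMem_tsupport hs, hε.le]

theorem smul_mem (U : ContinuousField A) {x : ∀ t, A t} (hx : x ∈ U.Θ) {c : Ω → ℂ}
    (hc : Continuous c) : (fun t => c t • x t) ∈ U.Θ :=
  U.smul_mem_of_tsupport_subset isOpen_univ (fun t => ContAt.of_mem U univ hx t) hc
    (subset_univ _)

theorem mem_of_eventuallyEq (U : ContinuousField A) {x : ∀ t, A t}
    (h : ∀ t, ∃ y ∈ U.Θ, ∀ᶠ s in 𝓝 t, x s = y s) : x ∈ U.Θ :=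
  U.mem_of_locally_approx x fun t ε hε => by
    obtain ⟨y, hy, hxy⟩ := h t
    exact ⟨y, hy, hxy.mono fun s hs => by simpa [hs] using hε.le⟩

theorem finsum_mem (U : ContinuousField A) {ι : Type*} {x : ι → ∀ t, A t} (hx : ∀ i, x i ∈ U.Θ)
    (hf : LocallyFinite fun i => {t | x i t ≠ 0}) : (fun t => ∑ᶠ i, x i t) ∈ U.Θ := by
  refine U.mem_of_eventuallyEq fun t => ?_
  obtain ⟨W, hW, hfin⟩ := hf t
  refine ⟨∑ i ∈ hfin.toFinset, x i, sum_mem fun i _ => hx i, ?_⟩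
  filter_upwards [hW] with s hs
  rw [Finset.sum_apply]
  exact finsum_eq_sum_of_support_subset _ fun i hi => by
    simpa using ⟨s, hi, hs⟩

/-! ### A global section that is strictly positive in every fibre -/

theorem exists_strictlyPositive_of_isTrivial (U : ContinuousField A) {V : Set Ω}
    (hV : (U.restrict V).IsTrivial) {p : Ω} (hp : p ∈ V) {h : A p}
    (hh : IsStrictlyPositiveElement h) :
    ∃ x : ∀ t, A t, (fun s : V => x s) ∈ (U.restrict V).Θ ∧
      ∀ t ∈ V, IsStrictlyPositiveElement (x t) := by
  classical
  obtain ⟨B, _, ⟨Φ⟩⟩ := hV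
  -- The constant section with value `h`, transported through the trivialization; its value `0` off
  -- `V` is arbitrary.
  refine ⟨fun t => if ht : t ∈ V then (Φ.φ ⟨t, ht⟩).symm (Φ.φ ⟨p, hp⟩ h) else 0, ?_, ?_⟩
  · rw [Φ.mem_iff]
    have : (fun t : V => Φ.φ t (if ht : (t : Ω) ∈ V then (Φ.φ ⟨t, ht⟩).symm (Φ.φ ⟨p, hp⟩ h) else 0))
        = fun _ => Φ.φ ⟨p, hp⟩ h := by
      funext t
      simp [t.2]
    rw [this]
    exact continuous_const (X := V)
  · intro t ht
    simp only [ht, dite_true]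
    exact (hh.map (Φ.φ ⟨p, hp⟩)).map (Φ.φ ⟨t, ht⟩).symm

/-- Strict positivity survives convex combinations, so local sections can be glued by a partition of
unity. -/
theorem exists_strictlyPositive [T2Space Ω] [ParacompactSpace Ω] (U : ContinuousField A)
    (hU : U.IsLocallyTrivial) (hA : ∀ t, ∃ h : A t, IsStrictlyPositiveElement h) :
    ∃ x ∈ U.Θ, ∀ t, IsStrictlyPositiveElement (x t) := by
  choose h hh using hA
  choose V hVo hVt hV using hU
  choose x hx hxV using fun p => U.exists_strictlyPositive_of_isTrivial (hV p) (hVt p) (hh p)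
  obtain ⟨ψ, hψ⟩ := PartitionOfUnity.exists_isSubordinate (isClosed_univ (X := Ω)) V hVo
    (fun t _ => mem_iUnion.2 ⟨t, hVt t⟩)
  have hne : ∀ p t, (ψ p t : ℂ) • x p t ≠ 0 → ψ p t ≠ 0 := fun p t h h0 => h (by simp [h0])
  refine ⟨fun t => ∑ᶠ p, (ψ p t : ℂ) • x p t, U.finsum_mem (fun p => ?_) ?_, fun t => ?_⟩
  · refine U.smul_mem_of_tsupport_subset (hVo p) (hx p) (c := fun t => (ψ p t : ℂ)) (by fun_prop) ?_
    refine (closure_mono ?_).trans (hψ p)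
    intro t ht
    simpa using ht
  · exact ψ.locallyFinite.subset fun p t ht => hne p t ht
  · have hft : (Function.support fun i => ψ i t).Finite := ψ.locallyFinite.point_finite t
    have e : ∑ᶠ p, (ψ p t : ℂ) • x p t = ∑ p ∈ hft.toFinset, (ψ p t : ℂ) • x p t :=
      finsum_eq_sum_of_support_subset _ fun p hp => by simpa using hne p t hp
    change IsStrictlyPositiveElement (∑ᶠ p, (ψ p t : ℂ) • x p t)
    rw [e]
    refine IsStrictlyPositiveElement.sum _ _ _ (fun p _ => ψ.nonneg p t) (fun p _ h0 => ?_) ?_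
    · exact hxV p t (hψ p (subset_tsupport _ h0))
    · obtain ⟨p, hp⟩ := ψ.exists_pos (mem_univ t)
      exact ⟨p, by simpa using hp.ne', hp.ne'⟩

/-! ### Evaluation on the algebra of sections -/

/-- The evaluation of bounded vector fields at a point, as a `*`-homomorphism. -/
def evalHom (A : Ω → Type v) [∀ t, NonUnitalCStarAlgebra (A t)] (t : Ω) : lp A ∞ →⋆ₙₐ[ℂ] A t where
  toFun x := x t
  map_smul' _ _ := rfl
  map_zero' := rfl
  map_add' _ _ := rfl
  map_mul' _ _ := rfl
  map_star' _ := rfl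

/-- The evaluation of the algebra of sections at a point. -/
def eval (U : ContinuousField A) (t : Ω) : U.sectionAlgebra →⋆ₙₐ[ℂ] A t :=
  (evalHom A t).comp (NonUnitalStarSubalgebraClass.subtype U.sectionAlgebra)

theorem eval_apply (U : ContinuousField A) (t : Ω) (a : U.sectionAlgebra) :
    U.eval t a = (a : lp A ∞) t := rfl

theorem norm_le_of_eval (U : ContinuousField A) {a : U.sectionAlgebra} {C : ℝ} (hC : 0 ≤ C)
    (h : ∀ t, ‖U.eval t a‖ ≤ C) : ‖a‖ ≤ C :=
  lp.norm_le_of_forall_le hC h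

theorem ext_eval (U : ContinuousField A) {a b : U.sectionAlgebra}
    (h : ∀ t, U.eval t a = U.eval t b) : a = b :=
  Subtype.ext (lp.ext (funext h))

theorem exists_eval_of_isCompact [T2Space Ω] (U : ContinuousField A) {x : ∀ t, A t} (hx : x ∈ U.Θ)
    {K : Set Ω} (hK : IsCompact K) (h0 : ∀ t ∉ K, x t = 0) :
    ∃ a : U.sectionAlgebra, ∀ t, U.eval t a = x t := by
  refine U.exists_mem_sectionAlgebra x hx (tendsto_const_nhds.congr' ?_)
  filter_upwards [hK.compl_mem_cocompact] with t ht
  rw [h0 t ht, norm_zero]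

theorem exists_eval_smul [T2Space Ω] (U : ContinuousField A) {x : ∀ t, A t} (hx : x ∈ U.Θ)
    {c : Ω → ℝ} (hc : Continuous c) (hcs : HasCompactSupport c) :
    ∃ a : U.sectionAlgebra, ∀ t, U.eval t a = (c t : ℂ) • x t :=
  U.exists_eval_of_isCompact (U.smul_mem hx (c := fun t => (c t : ℂ)) (by fun_prop)) hcs
    fun t ht => by simp [image_eq_zero_of_notMem_tsupport ht]

/-- The continuous functional calculus preserves continuity of vector fields. -/
theorem cfcₙ_mem [T2Space Ω] [LocallyCompactSpace Ω] (U : ContinuousField A) {x : ∀ t, A t}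
    (hx : x ∈ U.Θ) (hsa : ∀ t, IsSelfAdjoint (x t)) {g : ℝ → ℝ} (hg : Continuous g) (hg0 : g 0 = 0) :
    (fun t => cfcₙ g (x t)) ∈ U.Θ := by
  refine U.mem_of_eventuallyEq fun t => ?_
  obtain ⟨K, hK, hKt⟩ := exists_compact_mem_nhds t
  -- Since `x` need not vanish at infinity, `χ • x` is used: it lies in the algebra of sections,
  -- where the calculus commutes with evaluation, and it agrees with `x` near `t`.
  obtain ⟨χ, hχ1, -, hχc, -⟩ := exists_continuous_one_zero_of_isCompact hK isClosed_empty
    (disjoint_empty K)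
  obtain ⟨a, ha⟩ := U.exists_eval_smul hx χ.continuous hχc
  have hasa : IsSelfAdjoint (a : lp A ∞) := by
    refine lp.ext (funext fun s => ?_)
    have h1 : U.eval s a = (χ s : ℂ) • x s := ha s
    rw [eval_apply] at h1
    rw [lp.star_apply, h1, star_smul, (hsa s).star_eq, Complex.star_def, Complex.conj_ofReal]
  obtain ⟨b, hb, hba⟩ := U.sectionAlgebra.exists_map_eq_cfcₙ a.2 hasa hg hg0 (evalHom A)
  refine ⟨_, hb.1, ?_⟩
  filter_upwards [hKt] with s hs
  have h2 : evalHom A s (a : lp A ∞) = x s := by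
    change U.eval s a = x s
    rw [ha, hχ1 hs]; simp
  rw [← h2]
  exact (hba s).symm

end ContinuousField

/-! ### The diagonal family in the algebra of sections -/

namespace ContinuousField

variable {Ω : Type u} [TopologicalSpace Ω] {A : Ω → Type v} [∀ t, NonUnitalCStarAlgebra (A t)]

/-- Signed sums of products of two families, of functions and of elements, with at most two
functions non-zero. -/
theorem norm_sum_smul_le_four {E ι ι' : Type*} [NormedAddCommGroup E] [NormedSpace ℂ E] {c : ι → ℝ}
    (h0 : ∀ i, 0 ≤ c i) (h1 : ∀ i, c i ≤ 1) (h2 : ∃ i j, ∀ k, c k ≠ 0 → k = i ∨ k = j)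
    {q : ι' → E} (hq : ∀ (F : Finset ι') (ε : ι' → ℂ), (∀ k, ‖ε k‖ ≤ 1) →
      ‖∑ k ∈ F, ε k • q k‖ ≤ 2)
    (F : Finset (ι × ι')) (ε : ι × ι' → ℂ) (hε : ∀ k, ‖ε k‖ ≤ 1) :
    ‖∑ p ∈ F, ε p • (c p.1 : ℂ) • q p.2‖ ≤ 4 := by
  classical
  -- Padding by zero extends the sum from `F` to a rectangle; coefficients of modulus less than `1`
  -- are allowed for this reason.
  let ε' : ι × ι' → ℂ := fun p => if p ∈ F then ε p else 0
  have hε' : ∀ p, ‖ε' p‖ ≤ 1 := fun p => by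
    by_cases hp : p ∈ F
    · simpa [ε', hp] using hε p
    · simp [ε', hp]
  have e : ∑ p ∈ F, ε p • (c p.1 : ℂ) • q p.2 =
      ∑ i ∈ F.image Prod.fst, (c i : ℂ) • ∑ k ∈ F.image Prod.snd, ε' (i, k) • q k := by
    simp_rw [Finset.smul_sum]
    rw [← Finset.sum_product', ← Finset.sum_subset
      (s₁ := F) (s₂ := F.image Prod.fst ×ˢ F.image Prod.snd)
      (f := fun p => (c p.1 : ℂ) • ε' p • q p.2)]
    · refine Finset.sum_congr rfl fun p hp => ?_
      simp only [ε', hp, if_true]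
      rw [smul_comm]
    · intro p hp
      exact Finset.mem_product.2 ⟨Finset.mem_image_of_mem _ hp, Finset.mem_image_of_mem _ hp⟩
    · intro p _ hp
      simp [ε', hp]
  rw [e]
  calc _ ≤ ∑ i ∈ F.image Prod.fst, c i * 2 := by
        refine norm_sum_le_of_le _ fun i _ => ?_
        rw [norm_smul, Complex.norm_real, Real.norm_of_nonneg (h0 i)]
        exact mul_le_mul_of_nonneg_left (hq _ _ fun k => hε' (i, k)) (h0 i)
    _ ≤ 4 := by
        rw [← Finset.sum_mul]
        linarith [sum_le_two h0 h1 h2 (F.image Prod.fst)]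

/-- The functional calculus cut-offs of a fibrewise strictly positive field form an approximate
identity uniformly on compact sets. -/
theorem exists_cutoff_approx (U : ContinuousField A) {x : ∀ t, A t}
    (hx : ∀ t, IsStrictlyPositiveElement (x t)) (hxw : ∀ n, (fun t => cfcₙ (cutoff n) (x t)) ∈ U.Θ)
    {a : ∀ t, A t} (ha : a ∈ U.Θ) {K : Set Ω} (hK : IsCompact K) {ε : ℝ} (hε : 0 < ε) :
    ∃ n, ∀ t ∈ K, ‖a t - a t * cfcₙ (cutoff n) (x t)‖ ≤ 2 * ε := by
  choose n hn using fun t => (hx t).exists_norm_sub_mul_cutoff_lt (a t) hε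
  have hopen : ∀ t, ∀ᶠ s in 𝓝 t, ‖a s - a s * cfcₙ (cutoff (n t)) (x s)‖ < ε := fun t =>
    (U.continuous_norm _ (sub_mem ha (mul_mem ha (hxw (n t))))).continuousAt.eventually_lt_const
      (hn t)
  obtain ⟨T, -, hT⟩ := hK.elim_nhds_subcover _ fun t _ => hopen t
  -- An index above all those of the finite subcover: the larger cut-off absorbs each local one, so
  -- the error is `y - y * e` with `‖y‖ < ε` and `‖e‖ ≤ 1`.
  refine ⟨T.sup n + 1, fun t ht => ?_⟩
  obtain ⟨p, hp, hpt⟩ := mem_iUnion₂.1 (hT ht)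
  have hlt : n p < T.sup n + 1 := Nat.lt_succ_of_le (Finset.le_sup hp)
  set y := a t - a t * cfcₙ (cutoff (n p)) (x t)
  have e : a t - a t * cfcₙ (cutoff (T.sup n + 1)) (x t) =
      y - y * cfcₙ (cutoff (T.sup n + 1)) (x t) := by
    simp only [y, sub_mul, mul_assoc, cfcₙ_cutoff_mul_cutoff hlt]
    abel
  have h1 : ‖y * cfcₙ (cutoff (T.sup n + 1)) (x t)‖ ≤ ‖y‖ * 1 :=
    (norm_mul_le _ _).trans (by gcongr; exact norm_cutoff_le _ _)
  rw [e]
  have h2 : ‖y‖ < ε := hpt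
  linarith [norm_sub_le y (y * cfcₙ (cutoff (T.sup n + 1)) (x t))]

theorem exists_isDiagonalFamily [T2Space Ω] [LocallyCompactSpace Ω] [ParacompactSpace Ω]
    (U : ContinuousField A) (hU : U.IsLocallyTrivial)
    (hA : ∀ t, ∃ h : A t, IsStrictlyPositiveElement h) :
    ∃ (κ : Type u) (f : κ → U.sectionAlgebra), IsDiagonalFamily f 4 := by
  classical
  obtain ⟨x, hx, hxp⟩ := U.exists_strictlyPositive hU hA
  obtain ⟨ι, θ, hθc, hθ2⟩ := exists_partitionOfUnity_multiplicity_two Ω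
  have hsa : ∀ t, IsSelfAdjoint (x t) := fun t => (hxp t).isSelfAdjoint
  have hw : ∀ n, (fun t => cfcₙ (cutoff n) (x t)) ∈ U.Θ := fun n =>
    U.cfcₙ_mem hx hsa (continuous_cutoff n) (cutoff_apply_zero n)
  have hg : ∀ k, (fun t => cfcₙ (cutoffSqrt k) (x t)) ∈ U.Θ := fun k =>
    U.cfcₙ_mem hx hsa (continuous_cutoffSqrt k) (cutoffSqrt_apply_zero k)
  choose f hf using fun p : ι × ℕ => U.exists_eval_smul (hg p.2)
    (c := fun t => √(θ p.1 t)) (by fun_prop) ((hθc p.1).comp_left Real.sqrt_zero)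
  refine ⟨ι × ℕ, f, fun F ε hε => U.norm_le_of_eval (by norm_num) fun t => ?_, ?_⟩
  · simp_rw [map_sum, map_smul, hf]
    refine norm_sum_smul_le_four (c := fun i => √(θ i t)) (fun i => Real.sqrt_nonneg _)
      (fun i => Real.sqrt_le_one.2 (θ.le_one i t)) ?_
      (norm_sum_cutoffSqrt_le (x t) (hsa t)) F ε hε
    obtain ⟨i, j, h⟩ := hθ2 t
    exact ⟨i, j, fun k hk => h k fun h0 => hk (by simp [h0])⟩
  · intro a
    rw [Metric.mem_closure_iff]
    intro ε hε
    obtain ⟨K, hK, hKa⟩ := mem_cocompact.1 (a.2.2.eventually_lt_const (show (0 : ℝ) < ε / 4 by positivity))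
    obtain ⟨n, hn⟩ := U.exists_cutoff_approx hxp hw a.2.1 hK (show (0 : ℝ) < ε / 8 by positivity)
    obtain ⟨χ, hχ1, -, hχc, hχ01⟩ := exists_continuous_one_zero_of_isCompact hK isClosed_empty
      (disjoint_empty K)
    -- `d = χ · a · cutoff n (x)` is near `a`: the error is at most `2 · ε / 8` on `K` and `2 ‖a t‖
    -- < ε / 2` off `K`. Compact support leaves finitely many `i`, and the cut-off finitely many
    -- `k`.
    obtain ⟨d, hd⟩ := U.exists_eval_smul (mul_mem a.2.1 (hw n)) χ.continuous hχc
    have hd : ∀ t, U.eval t d = (χ t : ℂ) • (U.eval t a * cfcₙ (cutoff n) (x t)) := hd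
    have hfin := θ.locallyFinite.finite_nonempty_inter_compact hχc
    -- The range includes `k = n`, as only `k > n` is annihilated; the squares then sum to `cutoff
    -- (n + 1)`, which absorbs `cutoff n`.
    refine ⟨d, ⟨hfin.toFinset ×ˢ Finset.range (n + 1),
      fun p hp => U.ext_eval fun t => ?_, U.ext_eval fun t => ?_⟩, ?_⟩
    · rw [map_mul, map_zero, hd, hf, smul_mul_smul_comm, mul_assoc]
      by_cases hpn : n < p.2
      · rw [cfcₙ_cutoff_mul_cutoffSqrt hpn, mul_zero, smul_zero]
      · have hχθ : χ t = 0 ∨ θ p.1 t = 0 := by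
          by_contra! h
          refine hp (Finset.mem_product.2 ⟨?_, ?_⟩)
          · simpa using ⟨t, h.2, subset_tsupport _ h.1⟩
          · exact Finset.mem_range.2 (by omega)
        rcases hχθ with h | h <;> simp [h]
    · have e : ∀ p : ι × ℕ, U.eval t (d * f p * f p) = ((χ t * θ p.1 t : ℝ) : ℂ) •
          (U.eval t a * cfcₙ (cutoff n) (x t) *
            (cfcₙ (cutoffSqrt p.2) (x t) * cfcₙ (cutoffSqrt p.2) (x t))) := fun p => by
        rw [map_mul, map_mul, hd, hf, smul_mul_smul_comm, smul_mul_smul_comm]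
        simp only [mul_assoc]
        congr 1
        rw [← Complex.ofReal_mul, ← Complex.ofReal_mul, Real.mul_self_sqrt (θ.nonneg p.1 t)]
      rw [map_sum, Finset.sum_congr rfl fun p _ => e p, Finset.sum_product]
      simp_rw [← Finset.smul_sum, ← Finset.mul_sum, sum_cfcₙ_cutoffSqrt_sq]
      rw [← Finset.sum_smul, mul_assoc, cfcₙ_cutoff_mul_cutoff n.lt_succ_self, hd,
        ← Complex.ofReal_sum, ← Finset.mul_sum]
      by_cases hχ : χ t = 0
      · simp [hχ]
      · have : ∑ i ∈ hfin.toFinset, θ i t = 1 := by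
          rw [← θ.sum_eq_one (mem_univ t)]
          refine (finsum_eq_sum_of_support_subset _ fun i hi => ?_).symm
          simpa using ⟨t, hi, subset_tsupport _ hχ⟩
        rw [this, mul_one]
    · rw [dist_eq_norm]
      refine (U.norm_le_of_eval (by positivity) fun t => ?_).trans_lt (half_lt_self hε)
      rw [map_sub, hd]
      by_cases ht : t ∈ K
      · rw [hχ1 ht]
        have h1 : ‖U.eval t a - U.eval t a * cfcₙ (cutoff n) (x t)‖ ≤ 2 * (ε / 8) := hn t ht
        simpa using h1.trans (by linarith)
      · have h1 : ‖U.eval t a‖ < ε / 4 := hKa ht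
        have h2 : ‖(χ t : ℂ) • (U.eval t a * cfcₙ (cutoff n) (x t))‖ ≤ 1 * (‖U.eval t a‖ * 1) := by
          rw [norm_smul, Complex.norm_real, Real.norm_of_nonneg (hχ01 t).1]
          gcongr
          · exact (hχ01 t).2
          · exact (norm_mul_le _ _).trans (by gcongr; exact norm_cutoff_le _ _)
        linarith [norm_sub_le (U.eval t a) ((χ t : ℂ) • (U.eval t a * cfcₙ (cutoff n) (x t)))]

end ContinuousField

theorem theorem6p15 {Ω : Type u} [TopologicalSpace Ω] [T2Space Ω] [LocallyCompactSpace Ω]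
    [ParacompactSpace Ω] {A : Ω → Type v} [∀ t, NonUnitalCStarAlgebra (A t)]
    (U : ContinuousField A) (hU : U.IsLocallyTrivial)
    (hA : ∀ t, ∃ h : A t, IsStrictlyPositiveElement h) (ℓ : ℕ) (hℓ : 1 ≤ ℓ)
    (hdim : CoveringDimLE Ω ℓ ∨ U.IsNLocallyTrivial ℓ) :
    IsLeftProjective.{max u v, w} U.sectionAlgebra ∧
      ∃ ρ : U.sectionAlgebra →L[ℂ] ProjTensorSquare U.sectionAlgebra,
        (∀ a b : U.sectionAlgebra, ρ (a * b) = ProjTensorSquare.leftMul a (ρ b)) ∧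
        (∀ a : U.sectionAlgebra, ProjTensorSquare.mulMap (ρ a) = a) ∧
        ‖ρ‖ ≤ (4 * (ℓ : ℝ)) ^ 2 := by
  obtain ⟨κ, f, hf⟩ := U.exists_isDiagonalFamily hU hA
  -- The diagonal family has constant `C = 4`, so the splitting has norm at most `4 ^ 2`.
  have hle : (4 : ℝ) ^ 2 ≤ (4 * (ℓ : ℝ)) ^ 2 := by
    have : (1 : ℝ) ≤ ℓ := by exact_mod_cast hℓ
    gcongr
    linarith
  exact ⟨hf.isLeftProjective, hf.exists_splitting.imp fun ρ h => ⟨h.1, h.2.1, h.2.2.trans hle⟩⟩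

end
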